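/- Let $N\in\mathbb N$, $s\in(0,1)$, $N>2s$, and $2^*_s=\frac{2N}{N-2s}$. Let $V:\mathbb R^N\to\mathbb R$ and $f:\mathbb R^N\times\mathbb R\to\mathbb R$, and put $F(x,t)=\int_0^t f(x,\tau)\,d\tau$ and $G(x,t)=f(x,t)t-2F(x,t)$. Assume: (V1) $V$ is continuous and there are constants $\alpha,\beta$ with $0<\alpha\le V(x)\le\beta$ for all $x\in\mathbb R^N$; (f1) $f$ is continuous, $f(x+z,t)=f(x,t)$ for all $z\in\mathbb Z^N$, $x\in\mathbb R^N$, $t\in\mathbb R$, and $\lim_{|t|\to\infty} f(x,t)/|t|^{2^*_s-1}=0$ uniformly in $x\in\mathbb R^N$; (f2) $\lim_{t\to0} f(x,t)/t=0$ uniformly in $x\in\mathbb R^N$; (f3) $\lim_{|t|\to\infty}F(x,t)/|t|^2=+\infty$ for every $x\in\mathbb R^N$; (f4) there is $\lambda\ge1$ such that $G(x,\theta t)\le\lambda\,G(x,t)$ for all $(x,t)\in\mathbb R^N\times\mathbb R$ and $\theta\in[0,1]$. Let $H^s(\mathbb R^N)$ be the space of all $u\in L^2(\mathbb R^N)$ with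 $[u]^2:=\iint_{\mathbb R^{2N}}\frac{|u(x)-u(y)|^2}{|x-y|^{N+2s}}\,dx\,dy<\infty$, with the norm $\|u\|=\bigl([u]^2+\int_{\mathbb R^N}u^2\,dx\bigr)^{1/2}$, and let $$\mathcal J(u)=\frac12\Bigl([u]^2+\int_{\mathbb R^N}V(x)u^2\,dx\Bigr)-\int_{\mathbb R^N}F(x,u)\,dx,\qquad u\in H^s(\mathbb R^N).$$ Let $c\in\mathbb R$. Then every Cerami sequence for $\mathcal J$ at the level $c$, that is, every sequence $(v_n)$ in $H^s(\mathbb R^N)$ with $\mathcal J(v_n)\to c$ and $(1+\|v_n\|)\,\|\mathcal J'(v_n)\|_*\to0$, where $\mathcal J'$ is the Fréchet derivative and $\|\cdot\|_*$ is the norm of the dual of $H^s(\mathbb R^N)$, is bounded in $H^s(\mathbb R^N)$. -/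

import Mathlib

open MeasureTheory Filter Topology

noncomputable section

namespace FracSchrodinger

/-- Euclidean space of dimension `N`. -/
abbrev E (N : ℕ) : Type := EuclideanSpace ℝ (Fin N)

/-- The fractional difference quotient `(u(x) - u(y)) / |x - y|^(N/2 + s)`. -/
def diffQuot (N : ℕ) (s : ℝ) (u : E N → ℝ) (p : E N × E N) : ℝ :=
  (u p.1 - u p.2) / ‖p.1 - p.2‖ ^ ((N : ℝ) / 2 + s)

/-- The squared Gagliardo seminorm `∬ |u(x) - u(y)|^2 / |x - y|^(N + 2s) dx dy`. -/
def gagliardoSq (N : ℕ) (s : ℝ) (u : E N → ℝ) : ℝ :=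
  ∫ p : E N × E N, |u p.1 - u p.2| ^ 2 / ‖p.1 - p.2‖ ^ ((N : ℝ) + 2 * s)

theorem diffQuot_sq (N : ℕ) (s : ℝ) (u : E N → ℝ) (p : E N × E N) :
    diffQuot N s u p ^ 2 = |u p.1 - u p.2| ^ 2 / ‖p.1 - p.2‖ ^ ((N : ℝ) + 2 * s) := by
  have h : (‖p.1 - p.2‖ ^ ((N : ℝ) / 2 + s)) ^ 2 = ‖p.1 - p.2‖ ^ ((N : ℝ) + 2 * s) := by
    rw [← Real.rpow_natCast, ← Real.rpow_mul (norm_nonneg _)]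
    congr 1
    push_cast
    ring
  rw [diffQuot, div_pow, h, sq_abs]

theorem diffQuot_congr {N : ℕ} (s : ℝ) {u v : E N → ℝ} (h : u =ᵐ[volume] v) :
    diffQuot N s u =ᵐ[volume] diffQuot N s v := by
  have h1 : ∀ᵐ p : E N × E N, u p.1 = v p.1 :=
    Measure.quasiMeasurePreserving_fst.ae h
  have h2 : ∀ᵐ p : E N × E N, u p.2 = v p.2 :=
    Measure.quasiMeasurePreserving_snd.ae h
  filter_upwards [h1, h2] with p hp1 hp2
  simp only [diffQuot, hp1, hp2]

theorem diffQuot_add {N : ℕ} (s : ℝ) (u v : Lp ℝ 2 (volume : Measure (E N))) :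
    diffQuot N s ⇑(u + v) =ᵐ[volume] diffQuot N s u + diffQuot N s v := by
  refine (diffQuot_congr s (Lp.coeFn_add u v)).trans (Eventually.of_forall fun p => ?_)
  simp only [diffQuot, Pi.add_apply]
  ring

theorem diffQuot_smul {N : ℕ} (s a : ℝ) (u : Lp ℝ 2 (volume : Measure (E N))) :
    diffQuot N s ⇑(a • u) =ᵐ[volume] a • diffQuot N s u := by
  refine (diffQuot_congr s (Lp.coeFn_smul a u)).trans (Eventually.of_forall fun p => ?_)
  simp only [diffQuot, Pi.smul_apply, smul_eq_mul]
  ring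

/-- The functions `u ∈ L²(ℝᴺ)` with `(u(x) - u(y)) / |x - y|^(N/2 + s) ∈ L²(ℝᴺ × ℝᴺ)`,
as a subspace of `L²(ℝᴺ)`. -/
def hsSubmodule (N : ℕ) (s : ℝ) : Submodule ℝ (Lp ℝ 2 (volume : Measure (E N))) where
  carrier := {u | MemLp (diffQuot N s u) 2 volume}
  zero_mem' := by
    have h : diffQuot N s ⇑(0 : Lp ℝ 2 (volume : Measure (E N))) =ᵐ[volume] 0 := by
      refine (diffQuot_congr s (Lp.coeFn_zero ℝ 2 volume)).trans
        (Eventually.of_forall fun p => ?_)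
      simp [diffQuot]
    exact (memLp_congr_ae h).2 MemLp.zero
  add_mem' := fun {u v} hu hv => (memLp_congr_ae (diffQuot_add s u v)).2 (MemLp.add hu hv)
  smul_mem' := fun a u hu => (memLp_congr_ae (diffQuot_smul s a u)).2 (MemLp.const_smul hu a)

/-- The fractional Sobolev space `H^s(ℝᴺ)`. It is a type of its own, because its norm is not
the one which the subspace inherits from `L²(ℝᴺ)`. -/
def Hs (N : ℕ) (s : ℝ) : Type := hsSubmodule N s

namespace Hs

variable {N : ℕ} {s : ℝ}

instance : AddCommGroup (Hs N s) := inferInstanceAs (AddCommGroup (hsSubmodule N s))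

instance : Module ℝ (Hs N s) := inferInstanceAs (Module ℝ (hsSubmodule N s))

/-- The underlying element of `L²(ℝᴺ)`. -/
def toL2 : Hs N s →ₗ[ℝ] Lp ℝ 2 (volume : Measure (E N)) := (hsSubmodule N s).subtype

instance : CoeFun (Hs N s) (fun _ => E N → ℝ) := ⟨fun u => ⇑(toL2 u)⟩

theorem toL2_injective : Function.Injective (toL2 : Hs N s → _) := Subtype.val_injective

theorem memLp_diffQuot (u : Hs N s) : MemLp (diffQuot N s u) 2 volume := u.2

/-- The difference quotient as a linear map `H^s(ℝᴺ) → L²(ℝᴺ × ℝᴺ)`. -/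
def quot : Hs N s →ₗ[ℝ] Lp ℝ 2 (volume : Measure (E N × E N)) where
  toFun u := (memLp_diffQuot u).toLp _
  map_add' u v := by
    rw [← MemLp.toLp_add]
    exact MemLp.toLp_congr _ _ (diffQuot_add s (toL2 u) (toL2 v))
  map_smul' a u := by
    rw [RingHom.id_apply, ← MemLp.toLp_const_smul]
    exact MemLp.toLp_congr _ _ (diffQuot_smul s a (toL2 u))

/-- The standard norm `([u]² + |u|²_{L²})^(1/2)` of `H^s(ℝᴺ)`. -/
instance : Norm (Hs N s) := ⟨fun u => √(gagliardoSq N s u + ∫ x, u x ^ 2)⟩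

theorem norm_def (u : Hs N s) : ‖u‖ = √(gagliardoSq N s u + ∫ x, u x ^ 2) := rfl

theorem lp_norm_sq {X : Type*} [MeasurableSpace X] {μ : Measure X} (g : Lp ℝ 2 μ) :
    ‖g‖ ^ 2 = ∫ x, g x ^ 2 ∂μ := by
  rw [← real_inner_self_eq_norm_sq, L2.inner_def]
  refine integral_congr_ae (Eventually.of_forall fun x => ?_)
  simp [sq]

theorem norm_quot_sq (u : Hs N s) : ‖quot u‖ ^ 2 = gagliardoSq N s u := by
  rw [lp_norm_sq, gagliardoSq]
  refine integral_congr_ae ?_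
  filter_upwards [(memLp_diffQuot u).coeFn_toLp] with p hp
  rw [← diffQuot_sq, ← hp]
  rfl

/-- `H^s(ℝᴺ)` as a subspace of the Hilbert space `L²(ℝᴺ × ℝᴺ) × L²(ℝᴺ)`. -/
def embed : Hs N s →ₗ[ℝ]
    WithLp 2 (Lp ℝ 2 (volume : Measure (E N × E N)) × Lp ℝ 2 (volume : Measure (E N))) :=
  (WithLp.linearEquiv 2 ℝ _).symm.toLinearMap ∘ₗ (quot.prod toL2)

theorem norm_eq_embed (u : Hs N s) : ‖u‖ = ‖embed u‖ := by
  rw [WithLp.prod_norm_eq_of_L2, norm_def, ← norm_quot_sq, ← lp_norm_sq]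
  rfl

theorem embed_injective : Function.Injective (embed : Hs N s → _) := fun _ _ h =>
  toL2_injective (congrArg (fun z => (WithLp.ofLp z).2) h)

theorem core : NormedSpace.Core ℝ (Hs N s) where
  norm_nonneg u := Real.sqrt_nonneg _
  norm_smul a u := by rw [norm_eq_embed, norm_eq_embed, map_smul, norm_smul]
  norm_triangle u v := by
    rw [norm_eq_embed, norm_eq_embed, norm_eq_embed, map_add]
    exact norm_add_le _ _
  norm_eq_zero_iff u := by
    rw [norm_eq_embed, norm_eq_zero, map_eq_zero_iff _ embed_injective]

instance : NormedAddCommGroup (Hs N s) := NormedAddCommGroup.ofCore core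

instance : NormedSpace ℝ (Hs N s) := NormedSpace.ofCore core

end Hs

/-- The primitive `F(x,t) = ∫₀ᵗ f(x,τ) dτ`. -/
def primitive {N : ℕ} (f : E N → ℝ → ℝ) (x : E N) (t : ℝ) : ℝ := ∫ τ in (0 : ℝ)..t, f x τ

/-- `G(x,t) = f(x,t) t - 2 F(x,t)`. -/
def gFun {N : ℕ} (f : E N → ℝ → ℝ) (x : E N) (t : ℝ) : ℝ := f x t * t - 2 * primitive f x t

/-- The critical exponent `2N / (N - 2s)`. -/
def critExp (N : ℕ) (s : ℝ) : ℝ := 2 * (N : ℝ) / ((N : ℝ) - 2 * s)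

/-- `V` is continuous and `α ≤ V ≤ β` for some constants `0 < α ≤ β`. -/
def CondV1 {N : ℕ} (V : E N → ℝ) : Prop :=
  Continuous V ∧ ∃ α β : ℝ, 0 < α ∧ ∀ x, α ≤ V x ∧ V x ≤ β

/-- `f` is continuous, `1`-periodic in each coordinate of `x`, and
`f(x,t) / |t|^(2*_s - 1) → 0` as `|t| → ∞`, uniformly in `x`. -/
def CondF1 {N : ℕ} (s : ℝ) (f : E N → ℝ → ℝ) : Prop :=
  Continuous (fun p : E N × ℝ => f p.1 p.2) ∧
  (∀ (z : Fin N → ℤ) (x : E N) (t : ℝ), f (x + WithLp.toLp 2 (fun i => (z i : ℝ))) t = f x t) ∧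
  TendstoUniformly (fun (t : ℝ) (x : E N) => f x t / |t| ^ (critExp N s - 1)) (fun _ => 0)
    (comap (fun t : ℝ => |t|) atTop)

/-- `f(x,t) = o(t)` as `t → 0`, uniformly in `x`. -/
def CondF2 {N : ℕ} (f : E N → ℝ → ℝ) : Prop :=
  TendstoUniformly (fun (t : ℝ) (x : E N) => f x t / t) (fun _ => 0) (𝓝[≠] 0)

/-- `F(x,t) / |t|² → +∞` as `|t| → ∞`, for every `x`. -/
def CondF3 {N : ℕ} (f : E N → ℝ → ℝ) : Prop :=
  ∀ x : E N, Tendsto (fun t : ℝ => primitive f x t / |t| ^ 2) (comap (fun t : ℝ => |t|) atTop) atTop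

/-- There is `lam ≥ 1` with `G(x, θ t) ≤ lam G(x, t)` for all `x`, `t` and `θ ∈ [0,1]`. -/
def CondF4 {N : ℕ} (f : E N → ℝ → ℝ) : Prop :=
  ∃ lam : ℝ, 1 ≤ lam ∧ ∀ (x : E N) (t θ : ℝ), θ ∈ Set.Icc (0 : ℝ) 1 →
    gFun f x (θ * t) ≤ lam * gFun f x t

/-- The energy functional
`J(u) = ½ ([u]² + ∫ V u² dx) - ∫ F(x,u) dx` on `H^s(ℝᴺ)`. -/
def energy {N : ℕ} {s : ℝ} (V : E N → ℝ) (f : E N → ℝ → ℝ) (u : Hs N s) : ℝ :=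
  (1 / 2) * (gagliardoSq N s u + ∫ x, V x * u x ^ 2) - ∫ x, primitive f x (u x)

/-- `v` is a Cerami sequence for `J` at the level `c`:
`J(v n) → c` and `(1 + ‖v n‖) ‖J'(v n)‖_* → 0`, where `J'` is the Fréchet derivative and `‖·‖_*`
the norm of the dual space. -/
def IsCeramiSeq {X : Type*} [NormedAddCommGroup X] [NormedSpace ℝ X] (J : X → ℝ) (c : ℝ)
    (v : ℕ → X) : Prop :=
  Tendsto (fun n => J (v n)) atTop (𝓝 c) ∧
  Tendsto (fun n => (1 + ‖v n‖) * ‖fderiv ℝ J (v n)‖) atTop (𝓝 0)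

end FracSchrodinger

end

/-! ### Pointwise estimates for the nonlinearity and its primitive -/

namespace FracSchrodinger

variable {N : ℕ} {s : ℝ} {f : E N → ℝ → ℝ}

/-! The proof is a vanishing/concentration dichotomy in quantitative form: no weak limits,
subsequences or translated sequences occur. Let `v` have energy near `c`, `|J'(v)v| ≤ 1` and large
norm.

Vanishing is impossible (`exists_concentration`). Suppose no unit ball carries a fixed fraction
`δ‖v‖²` of the mass. Rescale `v` to `t₁v` of norm `ρ`. Its local mass is so small that `∫ F(x, t₁v)
≤ 1` (`exists_integral_primitive_le_one`), so `J(t₁v)` is of size `ρ²`, hence above `J(0) = 0` and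
`J(v)`. So `t ↦ J(tv)` has an interior maximum `t₀` on `[0,1]`, where `J'(t₀v)v = 0`. The identity
`2J(u) - J'(u)u = ∫ G(x,u)` and (f4) then give `2J(t₀v) = ∫ G(x,t₀v) ≤ λ ∫ G(x,v) = λ(2J(v) -
J'(v)v)`, which is bounded independently of `ρ`: a contradiction for `ρ` large.

Concentration bounds the norm (`exists_norm_le_of_concentration`). Since `F ≥ 0` and `F(x,t) ≥ Mt² -
MT²` uniformly in `x`, with `M` as large as desired, a ball with mass above `δ‖v‖²` makes `∫ F`
outweigh the quadratic part of `J`, while `J(v)` is bounded below.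

Three ingredients carry this. `exists_le_primitive` makes (f3) uniform in `x`, by periodicity and
the monotonicity of `F(x,σt)/σ²`. `sq_mul_volume_ball_le`, a comparison of `u(x)` with its values in
a ball, yields both the Sobolev inequality and the tail estimate for vanishing.
`energy_differentiableAt` shows that `fderiv` is the genuine derivative, not its default value `0`.
-/

theorem two_lt_critExp (hs : 0 < s) (hN : 2 * s < (N : ℝ)) : 2 < critExp N s := by
  rw [critExp, lt_div_iff₀ (by linarith)]
  linarith

/-- Every point of `ℝᴺ` has an integer translate in a fixed compact set. -/
theorem exists_isCompact_translate (N : ℕ) :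
    ∃ K : Set (E N), IsCompact K ∧
      ∀ x : E N, ∃ z : Fin N → ℤ, x + WithLp.toLp 2 (fun i => (z i : ℝ)) ∈ K := by
  refine ⟨Metric.closedBall 0 √(N : ℝ), isCompact_closedBall _ _, fun x => ⟨fun i => -⌊x i⌋, ?_⟩⟩
  rw [mem_closedBall_zero_iff, EuclideanSpace.norm_eq]
  refine Real.sqrt_le_sqrt ?_
  calc _ ≤ ∑ _i : Fin N, (1 : ℝ) := by
        refine Finset.sum_le_sum fun i _ => ?_
        have h : (x + WithLp.toLp 2 (fun i => ((-⌊x i⌋ : ℤ) : ℝ))) i = Int.fract (x i) := by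
          simp [Int.fract, sub_eq_add_neg]
        rw [h, Real.norm_eq_abs, abs_of_nonneg (Int.fract_nonneg _)]
        nlinarith [Int.fract_nonneg (x i), Int.fract_lt_one (x i)]
    _ = N := by simp

/-- Continuous periodic functions are bounded on bands `|t| ≤ M`. -/
theorem exists_bound_on_band (hc : Continuous (fun p : E N × ℝ => f p.1 p.2))
    (hp : ∀ (z : Fin N → ℤ) (x : E N) (t : ℝ),
      f (x + WithLp.toLp 2 (fun i => (z i : ℝ))) t = f x t) (M : ℝ) :
    ∃ C : ℝ, 0 ≤ C ∧ ∀ x t, |t| ≤ M → |f x t| ≤ C := by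
  obtain ⟨K, hK, hKx⟩ := exists_isCompact_translate N
  obtain ⟨C, hC⟩ := (hK.prod (isCompact_Icc (a := -M) (b := M))).exists_bound_of_continuousOn
    hc.continuousOn
  refine ⟨max C 0, le_max_right _ _, fun x t ht => ?_⟩
  obtain ⟨z, hz⟩ := hKx x
  rw [← hp z x t]
  exact (hC (_, t) ⟨hz, abs_le.1 ht⟩).trans (le_max_left _ _)

/-- Continuous periodic functions are equicontinuous in `t` on bands `|t| ≤ M`. -/
theorem exists_modulus_on_band (hc : Continuous (fun p : E N × ℝ => f p.1 p.2))
    (hp : ∀ (z : Fin N → ℤ) (x : E N) (t : ℝ),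
      f (x + WithLp.toLp 2 (fun i => (z i : ℝ))) t = f x t) (M : ℝ) {ε : ℝ} (hε : 0 < ε) :
    ∃ η : ℝ, 0 < η ∧ ∀ x t k, |t| ≤ M → |k| < η → |f x (t + k) - f x t| ≤ ε := by
  obtain ⟨K, hK, hKx⟩ := exists_isCompact_translate N
  have hu := (hK.prod (isCompact_Icc (a := -(M + 1)) (b := M + 1))).uniformContinuousOn_of_continuous
    hc.continuousOn
  obtain ⟨η, hη, h⟩ := Metric.uniformContinuousOn_iff.1 hu ε hε
  -- The cap at `1` keeps `t + k` inside the enlarged band `|t| ≤ M + 1` on which uniform continuity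
  -- was taken.
  refine ⟨min η 1, by positivity, fun x t k ht hk => ?_⟩
  obtain ⟨z, hz⟩ := hKx x
  rw [← hp z x (t + k), ← hp z x t]
  have hk1 : |k| < 1 := hk.trans_le (min_le_right _ _)
  have hkη : |k| < η := hk.trans_le (min_le_left _ _)
  have h1 := abs_le.1 ht
  have h2 := abs_lt.1 hk1
  refine (h (_, t + k) ⟨hz, ⟨by linarith, by linarith⟩⟩ (_, t) ⟨hz, ⟨by linarith, by linarith⟩⟩
    ?_).le
  simpa [Prod.dist_eq, Real.dist_eq, hη] using hkη

theorem CondF2.zero (hf2 : CondF2 f) (hc : Continuous (fun p : E N × ℝ => f p.1 p.2)) (x : E N) :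
    f x 0 = 0 := by
  have h1 : Tendsto (fun t => f x t / t) (𝓝[≠] 0) (𝓝 0) := hf2.tendsto_at x
  have h2 : Tendsto (fun t : ℝ => f x t / t * t) (𝓝[≠] 0) (𝓝 (0 * 0)) :=
    h1.mul (tendsto_id.mono_left nhdsWithin_le_nhds)
  have h3 : Tendsto (fun t : ℝ => f x t) (𝓝[≠] 0) (𝓝 (0 * 0)) := by
    refine h2.congr' ?_
    filter_upwards [self_mem_nhdsWithin] with t ht
    exact div_mul_cancel₀ _ ht
  have h4 : Continuous (f x) := hc.comp (by fun_prop : Continuous fun t : ℝ => (x, t))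
  have := tendsto_nhds_unique h3 (h4.continuousAt.tendsto.mono_left nhdsWithin_le_nhds)
  simpa using this.symm

theorem CondF2.exists_le (hf2 : CondF2 f) (hc : Continuous (fun p : E N × ℝ => f p.1 p.2))
    {ε : ℝ} (hε : 0 < ε) : ∃ a : ℝ, 0 < a ∧ ∀ x t, |t| ≤ a → |f x t| ≤ ε * |t| := by
  have h := Metric.tendstoUniformly_iff.1 hf2 ε hε
  obtain ⟨a, ha, h⟩ := Metric.mem_nhdsWithin_iff.1 h
  refine ⟨a / 2, by positivity, fun x t ht => ?_⟩
  rcases eq_or_ne t 0 with rfl | h0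
  · simp [hf2.zero hc x]
  · have : dist (0 : ℝ) (f x t / t) < ε :=
      h ⟨by rw [mem_ball_zero_iff, Real.norm_eq_abs]; linarith, h0⟩ x
    rw [dist_zero_left, Real.norm_eq_abs, abs_div, div_lt_iff₀ (abs_pos.2 h0)] at this
    exact this.le

theorem CondF1.exists_le (hf1 : CondF1 s f) {ε : ℝ} (hε : 0 < ε) :
    ∃ C : ℝ, 0 ≤ C ∧ ∀ x t, |f x t| ≤ ε * |t| ^ (critExp N s - 1) + C := by
  obtain ⟨hc, hp, hl⟩ := hf1
  have h := Metric.tendstoUniformly_iff.1 hl ε hε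
  obtain ⟨B, -, hB⟩ := ((atTop_basis (α := ℝ)).comap (fun t : ℝ => |t|)).mem_iff.1 h
  obtain ⟨C, hC0, hC⟩ := exists_bound_on_band hc hp (max B 1)
  refine ⟨C, hC0, fun x t => ?_⟩
  rcases le_total |t| (max B 1) with ht | ht
  · have : 0 ≤ ε * |t| ^ (critExp N s - 1) := by positivity
    linarith [hC x t ht]
  · have h0 : 0 < |t| := lt_of_lt_of_le one_pos ((le_max_right _ _).trans ht)
    have : dist (0 : ℝ) (f x t / |t| ^ (critExp N s - 1)) < ε :=
      hB (show |t| ∈ Set.Ici B from (le_max_left _ _).trans ht) x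
    have h1 : 0 < |t| ^ (critExp N s - 1) := by positivity
    rw [dist_zero_left, Real.norm_eq_abs, abs_div, abs_of_pos h1, div_lt_iff₀ h1] at this
    linarith

/-- Near `0` the hypothesis (f2) is already linear; for `|t| ≥ a` the additive constant of the
critical growth bound is at most `(C / a) |t|`. -/
theorem exists_le_add_linear (hf1 : CondF1 s f) (hf2 : CondF2 f) {ε : ℝ} (hε : 0 < ε) :
    ∃ C : ℝ, 0 ≤ C ∧ ∀ x t, |f x t| ≤ ε * |t| ^ (critExp N s - 1) + C * |t| := by
  obtain ⟨C, hC0, hC⟩ := hf1.exists_le hε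
  obtain ⟨a, ha, hfa⟩ := hf2.exists_le hf1.1 one_pos
  refine ⟨1 + C / a, by positivity, fun x t => ?_⟩
  have h1 : 0 ≤ ε * |t| ^ (critExp N s - 1) := by positivity
  have h2 : 0 ≤ C / a * |t| := by positivity
  rcases le_total |t| a with ht | ht
  · linarith [hfa x t ht]
  · have : C ≤ C / a * |t| := by
      calc C = C / a * a := by field_simp
        _ ≤ _ := by gcongr
    linarith [hC x t, abs_nonneg t]

theorem add_rpow_le_two_rpow_mul {q a b : ℝ} (hq : 0 ≤ q) (ha : 0 ≤ a) (hb : 0 ≤ b) :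
    (a + b) ^ q ≤ 2 ^ q * (a ^ q + b ^ q) := by
  have ha' := Real.rpow_nonneg ha q
  have hb' := Real.rpow_nonneg hb q
  rcases le_total a b with h | h
  · calc (a + b) ^ q ≤ (2 * b) ^ q := Real.rpow_le_rpow (by positivity) (by linarith) hq
      _ = 2 ^ q * b ^ q := Real.mul_rpow (by norm_num) hb
      _ ≤ _ := by gcongr; linarith
  · calc (a + b) ^ q ≤ (2 * a) ^ q := Real.rpow_le_rpow (by positivity) (by linarith) hq
      _ = 2 ^ q * a ^ q := Real.mul_rpow (by norm_num) ha
      _ ≤ _ := by gcongr; linarith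

/-- Quantitative continuity of the nonlinearity. -/
theorem exists_increment_le (hs : 0 < s) (hN : 2 * s < (N : ℝ)) (hf1 : CondF1 s f)
    (hf2 : CondF2 f) {ε : ℝ} (hε : 0 < ε) :
    ∃ C : ℝ, 0 ≤ C ∧ ∀ x t h k, |k| ≤ |h| →
      |f x (t + k) - f x t| ≤ ε * (|t| + |t| ^ (critExp N s - 1)) +
        C * (|h| + |h| ^ (critExp N s - 1)) := by
  have hp := two_lt_critExp hs hN
  set q := critExp N s - 1 with hq
  have hq0 : 0 ≤ q := by linarith
  set c : ℝ := 2 ^ q with hc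
  have hc0 : 0 < c := by positivity
  -- The cases below cost at most `e (c + 1)` on the power of `|t|` and `2 e` on `|t|`; both are at
  -- most `e (c + 2) = ε`.
  set e := ε / (c + 2) with he
  have he0 : 0 < e := by positivity
  have hee : e * (c + 2) = ε := by rw [he]; field_simp
  obtain ⟨C, hC0, hC⟩ := hf1.exists_le he0
  obtain ⟨a, ha, hfa⟩ := hf2.exists_le hf1.1 he0
  obtain ⟨η, hη, hfη⟩ := exists_modulus_on_band hf1.1 hf1.2.1 (2 * C / e)
    (show 0 < e * (a / 2) by positivity)
  set r := min η (a / 2) with hr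
  have hr0 : 0 < r := by positivity
  refine ⟨e * c + 2 * C / r + e, by positivity, fun x t h k hk => ?_⟩
  have hT : 0 ≤ |t| ^ q := by positivity
  have hH : 0 ≤ |h| ^ q := by positivity
  have ht0 := abs_nonneg t
  have hh0 := abs_nonneg h
  have hrhs : e * (c + 1) * |t| ^ q + 2 * e * |t| + (e * c) * |h| ^ q +
      (2 * C / r) * |h| + e * |h| ≤ ε * (|t| + |t| ^ q) + (e * c + 2 * C / r + e) * (|h| + |h| ^ q) := by
    rw [← hee]
    have h1 : 0 ≤ e * |t| ^ q := by positivity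
    have h2 : 0 ≤ e * c * |t| := by positivity
    have h3 : 0 ≤ e * c * |h| := by positivity
    have h4 : 0 ≤ 2 * C / r * |h| ^ q := by positivity
    have h5 : 0 ≤ e * |h| ^ q := by positivity
    nlinarith
  refine le_trans ?_ hrhs
  have p1 : 0 ≤ e * (c + 1) * |t| ^ q := by positivity
  have p2 : 0 ≤ e * |t| := by positivity
  have p3 : 0 ≤ e * c * |h| ^ q := by positivity
  have p4 : 0 ≤ (2 * C / r) * |h| := by positivity
  have p5 : 0 ≤ e * |h| := by positivity
  -- The growth bound leaves only the constant `2 * C` to absorb. For large `|t|` it goes into `e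
  -- |t|`; for `|k| ≥ r` into a multiple of `|h|`. The remaining cases, with `|t|` bounded and `|k|`
  -- small, use equicontinuity away from `t = 0` and (f2) near it.
  have base : |f x (t + k) - f x t| ≤ e * (c + 1) * |t| ^ q + (e * c) * |h| ^ q + 2 * C := by
    have h1 : |t + k| ^ q ≤ c * (|t| ^ q + |h| ^ q) :=
      (Real.rpow_le_rpow (abs_nonneg _) ((abs_add_le t k).trans (by gcongr)) hq0).trans
        (add_rpow_le_two_rpow_mul hq0 ht0 hh0)
    have h2 : e * |t + k| ^ q ≤ e * (c * (|t| ^ q + |h| ^ q)) := by gcongr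
    linarith [abs_sub (f x (t + k)) (f x t), hC x (t + k), hC x t]
  rcases le_total (2 * C / e) |t| with hB | hB
  · have : 2 * C ≤ e * |t| := by rwa [div_le_iff₀' he0] at hB
    linarith
  rcases le_or_gt r |k| with hkr | hkr
  · have : 2 * C ≤ (2 * C / r) * |h| := by
      calc 2 * C = (2 * C / r) * r := by field_simp
        _ ≤ _ := by gcongr; exact hkr.trans hk
    linarith
  rcases le_total (a / 2) |t| with hat | hat
  · have h1 := hfη x t k hB (hkr.trans_le (min_le_left _ _))
    have : e * (a / 2) ≤ e * |t| := by gcongr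
    linarith
  · have hka : |k| ≤ a / 2 := hkr.le.trans (min_le_right _ _)
    have h1 := hfa x t (by linarith)
    have h2 := hfa x (t + k) ((abs_add_le t k).trans (by linarith))
    have h3 : e * |t + k| ≤ e * (|t| + |h|) := by
      gcongr; exact (abs_add_le t k).trans (by gcongr)
    linarith [abs_sub (f x (t + k)) (f x t)]

theorem continuous_primitive (hc : Continuous (fun p : E N × ℝ => f p.1 p.2)) :
    Continuous (fun p : E N × ℝ => primitive f p.1 p.2) := by
  have : Continuous (Function.uncurry fun (x : E N) (t : ℝ) => f x t) := hc
  exact intervalIntegral.continuous_parametric_primitive_of_continuous this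

theorem continuous_section (hc : Continuous (fun p : E N × ℝ => f p.1 p.2)) (x : E N) :
    Continuous (f x) :=
  hc.comp (by fun_prop : Continuous fun t : ℝ => (x, t))

theorem hasDerivAt_primitive (hc : Continuous (fun p : E N × ℝ => f p.1 p.2)) (x : E N) (t : ℝ) :
    HasDerivAt (primitive f x) (f x t) t :=
  (continuous_section hc x).integral_hasStrictDerivAt 0 t |>.hasDerivAt

theorem primitive_zero (x : E N) : primitive f x 0 = 0 := by simp [primitive]

/-- A bound of `f` between `0` and `t` bounds the primitive. -/
theorem abs_primitive_le {x : E N} {t A : ℝ} (h : ∀ τ, |τ| ≤ |t| → |f x τ| ≤ A) :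
    |primitive f x t| ≤ A * |t| := by
  have := intervalIntegral.norm_integral_le_of_norm_le_const (a := 0) (b := t) (f := f x) (C := A)
    (fun τ hτ => h τ ?_)
  · simpa [primitive] using this
  · rcases Set.mem_uIoc.1 hτ with ⟨h1, h2⟩ | ⟨h1, h2⟩
    · rw [abs_of_pos h1, abs_of_nonneg (by linarith)]; exact h2
    · rw [abs_of_nonpos h2, abs_of_nonpos (by linarith)]; linarith

/-- The Taylor remainder is the integral of `f x τ - f x t` over an interval of length `|h|`. -/
theorem abs_primitive_sub_le (hc : Continuous (fun p : E N × ℝ => f p.1 p.2)) {x : E N}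
    {t h A : ℝ} (hA : ∀ k, |k| ≤ |h| → |f x (t + k) - f x t| ≤ A) :
    |primitive f x (t + h) - primitive f x t - f x t * h| ≤ A * |h| := by
  have hi : ∀ a b, IntervalIntegrable (f x) volume a b := fun a b =>
    (continuous_section hc x).intervalIntegrable a b
  have h1 : primitive f x (t + h) - primitive f x t - f x t * h =
      ∫ τ in t..(t + h), (f x τ - f x t) := by
    rw [primitive, primitive, intervalIntegral.integral_interval_sub_left (hi _ _) (hi _ _),
      intervalIntegral.integral_sub (hi _ _) (by simp), intervalIntegral.integral_const]
    simp [mul_comm]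
  rw [h1]
  have := intervalIntegral.norm_integral_le_of_norm_le_const (a := t) (b := t + h)
    (f := fun τ => f x τ - f x t) (C := A) (fun τ hτ => ?_)
  · simpa using this
  · have h2 := hA (τ - t) ?_
    · simpa using h2
    · rcases Set.mem_uIoc.1 hτ with ⟨h1, h2⟩ | ⟨h1, h2⟩
      · rw [abs_of_pos (by linarith), abs_of_nonneg (by linarith)]; linarith
      · rw [abs_of_nonpos (by linarith), abs_of_nonpos (by linarith)]; linarith

theorem exists_abs_primitive_le (hs : 0 < s) (hN : 2 * s < (N : ℝ)) (hf1 : CondF1 s f)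
    (hf2 : CondF2 f) {ε : ℝ} (hε : 0 < ε) :
    ∃ C : ℝ, 0 ≤ C ∧ ∀ x t, |primitive f x t| ≤ ε * |t| ^ critExp N s + C * t ^ 2 := by
  have hp := two_lt_critExp hs hN
  obtain ⟨C, hC0, hC⟩ := exists_le_add_linear hf1 hf2 hε
  refine ⟨C, hC0, fun x t => ?_⟩
  have h := abs_primitive_le (f := f) (x := x) (t := t)
    (A := ε * |t| ^ (critExp N s - 1) + C * |t|) (fun τ hτ => (hC x τ).trans (by
      gcongr; linarith))
  refine h.trans (le_of_eq ?_)
  rcases eq_or_ne t 0 with rfl | h0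
  · simp [Real.zero_rpow (show critExp N s ≠ 0 by linarith)]
  · have h1 : |t| ^ critExp N s = |t| ^ (critExp N s - 1) * |t| := by
      rw [← Real.rpow_add_one (abs_ne_zero.2 h0)]; simp
    rw [h1, ← sq_abs t]; ring

theorem CondF2.exists_abs_primitive_le (hf2 : CondF2 f)
    (hc : Continuous (fun p : E N × ℝ => f p.1 p.2)) {ε : ℝ} (hε : 0 < ε) :
    ∃ a : ℝ, 0 < a ∧ ∀ x t, |t| ≤ a → |primitive f x t| ≤ ε * t ^ 2 := by
  obtain ⟨a, ha, hfa⟩ := hf2.exists_le hc hε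
  refine ⟨a, ha, fun x t ht => ?_⟩
  have h := abs_primitive_le (f := f) (x := x) (t := t) (A := ε * |t|)
    (fun τ hτ => (hfa x τ (hτ.trans ht)).trans (by gcongr))
  calc _ ≤ _ := h
    _ = ε * t ^ 2 := by rw [← sq_abs t]; ring

/-- Take `θ = 0` in (f4): `G(x,0) = 0`. -/
theorem CondF4.gFun_nonneg (hf4 : CondF4 f) (x : E N) (t : ℝ) : 0 ≤ gFun f x t := by
  obtain ⟨l, hl, h⟩ := hf4
  have := h x t 0 ⟨le_rfl, zero_le_one⟩
  rw [zero_mul, gFun, primitive_zero] at this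
  simp only [mul_zero, sub_zero] at this
  exact nonneg_of_mul_nonneg_right this (by linarith)

/-- If `G ≥ 0` then `F(x, σt) / σ²` is nondecreasing in `σ > 0`. -/
theorem primitive_mul_div_sq_le (hc : Continuous (fun p : E N × ℝ => f p.1 p.2))
    (hG : ∀ x t, 0 ≤ gFun f x t) (x : E N) (t : ℝ) {σ τ : ℝ} (hσ : 0 < σ) (h : σ ≤ τ) :
    primitive f x (σ * t) / σ ^ 2 ≤ primitive f x (τ * t) / τ ^ 2 := by
  have hd : ∀ σ : ℝ, 0 < σ → HasDerivAt (fun σ : ℝ => primitive f x (σ * t) / σ ^ 2)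
      (((f x (σ * t) * t) * σ ^ 2 - primitive f x (σ * t) * (2 * σ)) / (σ ^ 2) ^ 2) σ := by
    intro σ hσ
    have h1 : HasDerivAt (fun σ : ℝ => primitive f x (σ * t)) (f x (σ * t) * t) σ := by
      have := (hasDerivAt_primitive hc x (σ * t)).comp σ ((hasDerivAt_id σ).mul_const t)
      simpa [Function.comp_def] using this
    have h2 : HasDerivAt (fun σ : ℝ => σ ^ 2) (2 * σ) σ := by
      simpa using hasDerivAt_pow 2 σ
    exact h1.div h2 (by positivity)
  have hm : MonotoneOn (fun σ : ℝ => primitive f x (σ * t) / σ ^ 2) (Set.Ioi 0) := by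
    refine monotoneOn_of_deriv_nonneg (convex_Ioi 0)
      (fun σ hσ => (hd σ hσ).continuousAt.continuousWithinAt)
      (fun σ hσ => (hd σ (by simpa using hσ)).differentiableAt.differentiableWithinAt)
      (fun σ hσ => ?_)
    have hσ : 0 < σ := by simpa using hσ
    rw [(hd σ hσ).deriv]
    refine div_nonneg ?_ (by positivity)
    -- The numerator of the derivative is `σ * gFun f x (σ * t)`.
    have := mul_nonneg hσ.le (hG x (σ * t))
    rw [gFun] at this
    linarith
  exact hm hσ (hσ.trans_le h) h

/-- By monotonicity `F(x,t) ≥ F(x,σt)/σ²` for `σ ≤ 1`, and by (f2) the right side is at least `-ε`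
once `σ` is small. -/
theorem primitive_nonneg (hc : Continuous (fun p : E N × ℝ => f p.1 p.2)) (hf2 : CondF2 f)
    (hG : ∀ x t, 0 ≤ gFun f x t) (x : E N) (t : ℝ) : 0 ≤ primitive f x t := by
  refine le_of_forall_pos_le_add fun ε hε => ?_
  obtain ⟨a, ha, h⟩ := hf2.exists_abs_primitive_le hc (show 0 < ε / (t ^ 2 + 1) by positivity)
  set σ := min 1 (a / (|t| + 1)) with hσd
  have hσ : 0 < σ := by positivity
  have h1 := primitive_mul_div_sq_le hc hG x t hσ (min_le_left _ _)
  simp only [one_mul, one_pow, div_one] at h1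
  have h2 := h x (σ * t) (by
    rw [abs_mul, abs_of_pos hσ]
    calc σ * |t| ≤ a / (|t| + 1) * (|t| + 1) := by gcongr; exacts [min_le_right _ _, by linarith]
      _ = a := by field_simp)
  have h3 := (abs_le.1 h2).1
  have h4 : -(ε / (t ^ 2 + 1) * t ^ 2) ≤ primitive f x (σ * t) / σ ^ 2 := by
    rw [le_div_iff₀ (by positivity)]
    linarith
  have h5 : ε / (t ^ 2 + 1) * t ^ 2 ≤ ε := by
    rw [div_mul_eq_mul_div, div_le_iff₀ (by positivity)]
    nlinarith
  linarith

/-- The primitive is superquadratic, uniformly in `x`. -/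
theorem exists_le_primitive (hf1 : CondF1 s f) (hf2 : CondF2 f) (hf3 : CondF3 f)
    (hf4 : CondF4 f) {M : ℝ} (hM : 0 ≤ M) :
    ∃ T : ℝ, 0 ≤ T ∧ ∀ x t, M * t ^ 2 - M * T ^ 2 ≤ primitive f x t := by
  obtain ⟨hc, hp, -⟩ := hf1
  have hG := hf4.gFun_nonneg
  have hF := primitive_nonneg hc hf2 hG
  obtain ⟨K, hK, hKx⟩ := exists_isCompact_translate N
  have key : ∃ T : ℝ, 0 ≤ T ∧ ∀ x ∈ K, ∀ t, M * t ^ 2 - M * T ^ 2 ≤ primitive f x t := by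
    -- The property passes to finite unions because enlarging `T` only weakens the bound, so
    -- compactness reduces it to a neighbourhood of each point.
    refine hK.induction_on (p := fun S => ∃ T : ℝ, 0 ≤ T ∧ ∀ x ∈ S, ∀ t,
      M * t ^ 2 - M * T ^ 2 ≤ primitive f x t) ⟨0, le_rfl, by simp⟩ ?_ ?_ ?_
    · rintro S S' hSS ⟨T, hT, h⟩
      exact ⟨T, hT, fun x hx => h x (hSS hx)⟩
    · rintro S S' ⟨T, hT, h⟩ ⟨T', hT', h'⟩
      refine ⟨max T T', by positivity, ?_⟩
      rintro x (hx | hx) t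
      · refine le_trans ?_ (h x hx t)
        have : T ^ 2 ≤ max T T' ^ 2 := by gcongr; exact le_max_left _ _
        nlinarith
      · refine le_trans ?_ (h' x hx t)
        have : T' ^ 2 ≤ max T T' ^ 2 := by gcongr; exact le_max_right _ _
        nlinarith
    · intro x _
      have h := (hf3 x).eventually (eventually_gt_atTop M)
      obtain ⟨B, -, hB⟩ := ((atTop_basis (α := ℝ)).comap (fun t : ℝ => |t|)).mem_iff.1 h
      set T := max B 1 with hT
      have hT0 : 0 < T := lt_of_lt_of_le one_pos (le_max_right _ _)
      have hTB : ∀ t, |t| = T → M * T ^ 2 < primitive f x t := fun t ht => by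
        have : M < primitive f x t / |t| ^ 2 :=
          hB (show B ≤ |t| from ht ▸ le_max_left _ _)
        rwa [ht, lt_div_iff₀ (by positivity)] at this
      have hcont : ∀ t, Continuous fun y => primitive f y t := fun t =>
        (continuous_primitive hc).comp (by fun_prop : Continuous fun y : E N => (y, t))
      -- Strict inequalities at the two values `±T` persist for nearby `y`. Monotonicity of
      -- `F(y,σt)/σ²` carries them to all `|t| ≥ T`; for `|t| ≤ T` the left side is nonpositive and
      -- `F ≥ 0` suffices.
      have e1 : ∀ᶠ y in 𝓝 x, M * T ^ 2 < primitive f y T :=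
        (hcont T).continuousAt.eventually_const_lt (hTB T (abs_of_pos hT0))
      have e2 : ∀ᶠ y in 𝓝 x, M * T ^ 2 < primitive f y (-T) :=
        (hcont (-T)).continuousAt.eventually_const_lt
          (hTB (-T) (by rw [abs_neg, abs_of_pos hT0]))
      refine ⟨_, mem_nhdsWithin_of_mem_nhds (e1.and e2), T, hT0.le, fun y hy t => ?_⟩
      rcases le_total |t| T with ht | ht
      · have : t ^ 2 ≤ T ^ 2 := by rw [← sq_abs]; gcongr
        nlinarith [hF y t]
      · have hσ : 1 ≤ |t| / T := by rwa [one_le_div hT0]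
        have hsc : ∀ t0, M * T ^ 2 < primitive f y t0 → |t| / T * t0 = t →
            M * t ^ 2 ≤ primitive f y t := fun t0 h0 h1 => by
          have := primitive_mul_div_sq_le hc hG y t0 one_pos hσ
          rw [h1] at this
          simp only [one_mul, one_pow, div_one] at this
          rw [le_div_iff₀ (by positivity)] at this
          have h2 : M * T ^ 2 * (|t| / T) ^ 2 = M * t ^ 2 := by
            rw [div_pow, sq_abs]; field_simp
          have h3 : M * T ^ 2 * (|t| / T) ^ 2 ≤ primitive f y t0 * (|t| / T) ^ 2 := by gcongr
          linarith
        have hMT : 0 ≤ M * T ^ 2 := by positivity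
        rcases le_total 0 t with h0 | h0
        · have := hsc T hy.1 (by rw [abs_of_nonneg h0]; field_simp)
          linarith
        · have := hsc (-T) hy.2 (by rw [abs_of_nonpos h0]; field_simp)
          linarith
  obtain ⟨T, hT, h⟩ := key
  refine ⟨T, hT, fun x t => ?_⟩
  obtain ⟨z, hz⟩ := hKx x
  have : primitive f (x + WithLp.toLp 2 (fun i => (z i : ℝ))) t = primitive f x t := by
    simp only [primitive, hp]
  rw [← this]
  exact h _ hz t

end FracSchrodinger

/-! ### The fractional Sobolev inequality and the tail estimate under small local mass -/

namespace FracSchrodinger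

variable {N : ℕ} {s : ℝ}

/-- The inner integral `∫ |u(x) - u(y)|² / |x - y|^(N + 2s) dy` of the Gagliardo seminorm. -/
noncomputable def gagliardoDensity (N : ℕ) (s : ℝ) (u : E N → ℝ) (x : E N) : ENNReal :=
  ∫⁻ y, ENNReal.ofReal (|u x - u y| ^ 2 / ‖x - y‖ ^ ((N : ℝ) + 2 * s))

/-- The volume of the unit ball. -/
noncomputable def ballVol (N : ℕ) : ℝ := (volume : Measure (E N)).real (Metric.ball 0 1)

theorem ballVol_pos (N : ℕ) : 0 < ballVol N :=
  ENNReal.toReal_pos (Metric.measure_ball_pos _ _ one_pos).ne' measure_ball_lt_top.ne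

theorem volume_ball_eq (x : E N) {r : ℝ} (hr : 0 < r) :
    volume (Metric.ball x r) = ENNReal.ofReal (ballVol N * r ^ N) := by
  rw [Measure.addHaar_ball_of_pos _ _ hr, finrank_euclideanSpace, Fintype.card_fin, mul_comm (ballVol N),
    ENNReal.ofReal_mul (by positivity), ballVol, ofReal_measureReal measure_ball_lt_top.ne]

theorem measurable_diffQuot_sq {u : E N → ℝ} (hu : Measurable u) :
    Measurable fun p : E N × E N =>
      ENNReal.ofReal (|u p.1 - u p.2| ^ 2 / ‖p.1 - p.2‖ ^ ((N : ℝ) + 2 * s)) := by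
  have h1 : Measurable fun p : E N × E N => |u p.1 - u p.2| ^ 2 := by
    have : Measurable fun p : E N × E N => u p.1 - u p.2 := by fun_prop
    exact (measurable_norm.comp this).pow_const 2
  have h2 : Measurable fun p : E N × E N => ‖p.1 - p.2‖ ^ ((N : ℝ) + 2 * s) := by fun_prop
  exact (h1.div h2).ennreal_ofReal

/-- The value at a point is controlled by the Gagliardo density and the mass of a ball. -/
theorem sq_mul_volume_ball_le (hs : 0 < s) {u : E N → ℝ} (hu : Measurable u) (x : E N) {r : ℝ}
    (hr : 0 < r) :
    ENNReal.ofReal (u x ^ 2) * volume (Metric.ball x r) ≤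
      ENNReal.ofReal (2 * r ^ ((N : ℝ) + 2 * s)) * gagliardoDensity N s u x +
        2 * ∫⁻ y in Metric.ball x r, ENNReal.ofReal (u y ^ 2) := by
  have hm : Measurable fun y : E N =>
      ENNReal.ofReal (|u x - u y| ^ 2 / ‖x - y‖ ^ ((N : ℝ) + 2 * s)) := by
    have h := (measurable_diffQuot_sq (s := s) hu).comp (measurable_prodMk_left (x := x))
    simpa only [Function.comp_def] using h
  have he : 0 ≤ (N : ℝ) + 2 * s := by positivity
  rw [← setLIntegral_const]
  calc ∫⁻ _y in Metric.ball x r, ENNReal.ofReal (u x ^ 2)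
      ≤ ∫⁻ y in Metric.ball x r, (ENNReal.ofReal (2 * r ^ ((N : ℝ) + 2 * s)) *
          ENNReal.ofReal (|u x - u y| ^ 2 / ‖x - y‖ ^ ((N : ℝ) + 2 * s)) +
          2 * ENNReal.ofReal (u y ^ 2)) := by
        refine setLIntegral_mono' measurableSet_ball fun y hy => ?_
        have h2 : 2 * ENNReal.ofReal (u y ^ 2) = ENNReal.ofReal (2 * u y ^ 2) := by
          rw [ENNReal.ofReal_mul (by norm_num)]; simp
        rw [h2, ← ENNReal.ofReal_mul (by positivity), ← ENNReal.ofReal_add (by positivity) (by positivity)]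
        refine ENNReal.ofReal_le_ofReal ?_
        have h3 : |u x - u y| ^ 2 ≤
            r ^ ((N : ℝ) + 2 * s) * (|u x - u y| ^ 2 / ‖x - y‖ ^ ((N : ℝ) + 2 * s)) := by
          rcases eq_or_ne x y with rfl | hxy
          · simp
          · have hpos : 0 < ‖x - y‖ := norm_pos_iff.2 (sub_ne_zero.2 hxy)
            have hle : ‖x - y‖ ≤ r := by
              rw [← dist_eq_norm, dist_comm]; exact (Metric.mem_ball.1 hy).le
            have h4 : ‖x - y‖ ^ ((N : ℝ) + 2 * s) ≤ r ^ ((N : ℝ) + 2 * s) :=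
              Real.rpow_le_rpow hpos.le hle he
            have h5 : 0 < ‖x - y‖ ^ ((N : ℝ) + 2 * s) := by positivity
            calc |u x - u y| ^ 2 = ‖x - y‖ ^ ((N : ℝ) + 2 * s) *
                  (|u x - u y| ^ 2 / ‖x - y‖ ^ ((N : ℝ) + 2 * s)) := by field_simp
              _ ≤ _ := by gcongr
        rw [sq_abs] at *
        -- The gap in `u(x)² ≤ 2(u(x) - u(y))² + 2u(y)²` is exactly this square.
        nlinarith [sq_nonneg (u x - 2 * u y)]
    _ = (ENNReal.ofReal (2 * r ^ ((N : ℝ) + 2 * s)) * ∫⁻ y in Metric.ball x r,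
          ENNReal.ofReal (|u x - u y| ^ 2 / ‖x - y‖ ^ ((N : ℝ) + 2 * s))) +
          2 * ∫⁻ y in Metric.ball x r, ENNReal.ofReal (u y ^ 2) := by
        rw [lintegral_add_left (hm.const_mul _), lintegral_const_mul _ hm,
          lintegral_const_mul _ (hu.pow_const 2).ennreal_ofReal]
    _ ≤ _ := by
        gcongr
        exact setLIntegral_le_lintegral _ _

/-- The real form of `sq_mul_volume_ball_le`. -/
theorem sq_mul_ballVol_le (hs : 0 < s) {u : E N → ℝ} (hu : Measurable u) {x : E N} {r b : ℝ}
    (hr : 0 < r) (hb : 0 ≤ b) (hD : gagliardoDensity N s u x ≠ ⊤)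
    (h : ∫⁻ y in Metric.ball x r, ENNReal.ofReal (u y ^ 2) ≤ ENNReal.ofReal b) :
    ballVol N * r ^ N * u x ^ 2 ≤
      2 * r ^ ((N : ℝ) + 2 * s) * (gagliardoDensity N s u x).toReal + 2 * b := by
  have h1 := sq_mul_volume_ball_le hs hu x hr
  have hω := ballVol_pos N
  have h2 : (2 : ENNReal) = ENNReal.ofReal 2 := by simp
  have h3 : ENNReal.ofReal (ballVol N * r ^ N * u x ^ 2) ≤ ENNReal.ofReal
      (2 * r ^ ((N : ℝ) + 2 * s) * (gagliardoDensity N s u x).toReal + 2 * b) := by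
    rw [ENNReal.ofReal_add (by positivity) (by positivity), ENNReal.ofReal_mul (by positivity),
      ENNReal.ofReal_mul (p := 2 * r ^ ((N : ℝ) + 2 * s)) (by positivity),
      ENNReal.ofReal_mul (p := 2) (q := b) (by positivity),
      ENNReal.ofReal_toReal hD, ← h2, mul_comm, ← volume_ball_eq x hr]
    exact h1.trans (by gcongr)
  exact (ENNReal.ofReal_le_ofReal_iff (by positivity)).1 h3

/-- Split at the level `k`. This trades local `L²` mass for `L^p` mass plus a multiple of the
volume. -/
theorem sq_le_add_rpow {p k a : ℝ} (hp : 2 ≤ p) (hk : 0 < k) (ha : 0 ≤ a) :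
    a ^ 2 ≤ k ^ 2 + k ^ (2 - p) * a ^ p := by
  rcases le_total a k with h | h
  · have : 0 ≤ k ^ (2 - p) * a ^ p := by positivity
    have : a ^ 2 ≤ k ^ 2 := by gcongr
    linarith
  · have h0 : 0 < a := hk.trans_le h
    have h1 : a ^ (2 - p) ≤ k ^ (2 - p) :=
      Real.rpow_le_rpow_of_nonpos hk h (by linarith)
    have h2 : a ^ 2 = a ^ (2 - p) * a ^ p := by
      rw [← Real.rpow_add h0, ← Real.rpow_natCast]; norm_num
    rw [h2]
    have : a ^ (2 - p) * a ^ p ≤ k ^ (2 - p) * a ^ p := by gcongr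
    nlinarith [sq_nonneg k]

/-- The pointwise inequality behind the fractional Sobolev inequality. -/
theorem exists_rpow_le_gagliardoDensity (hs : 0 < s) (hN : 2 * s < (N : ℝ)) :
    ∃ c : ℝ, 0 < c ∧ ∀ (u : E N → ℝ), Measurable u → ∀ I : ℝ, 0 < I →
      ∫⁻ y, ENNReal.ofReal (|u y| ^ critExp N s) ≤ ENNReal.ofReal I → ∀ x,
      ENNReal.ofReal (|u x| ^ critExp N s) ≤
        ENNReal.ofReal (c * I ^ (2 * s / N)) * gagliardoDensity N s u x := by
  have hp := two_lt_critExp hs hN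
  have hN0 : (0 : ℝ) < N := by linarith
  have hpe : critExp N s * (2 * s / N) = critExp N s - 2 := by
    have : (N : ℝ) - 2 * s ≠ 0 := by linarith
    rw [critExp]; field_simp; ring
  set p := critExp N s with hpdef
  have hω := ballVol_pos N
  -- With this `L` and `r ^ N = L * I / X ^ p`, the `L^p` contribution to the ball mass is `ballVol
  -- N * r ^ N * X ^ 2 / 8`; the level `X / 4` contributes one sixteenth of the same quantity.
  set L : ℝ := 8 * 4 ^ (p - 2) / ballVol N with hL
  have hL0 : 0 < L := by positivity
  refine ⟨4 / ballVol N * L ^ (2 * s / N), by positivity, fun u hu I hI huI x => ?_⟩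
  rcases eq_or_ne (u x) 0 with h0 | h0
  · rw [h0, abs_zero, Real.zero_rpow (by linarith)]; simp
  rcases eq_or_ne (gagliardoDensity N s u x) ⊤ with hD | hD
  · rw [hD, ENNReal.mul_top]
    · exact le_top
    · rw [Ne, ENNReal.ofReal_eq_zero, not_le]; positivity
  set X := |u x| with hX
  have hX0 : 0 < X := abs_pos.2 h0
  set r : ℝ := (L * I / X ^ p) ^ (1 / (N : ℝ)) with hr
  have hr0 : 0 < r := by positivity
  have hrN : r ^ N = L * I / X ^ p := by
    rw [← Real.rpow_natCast, hr, ← Real.rpow_mul (by positivity)]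
    have : 1 / (N : ℝ) * N = 1 := by field_simp
    rw [this, Real.rpow_one]
  have hr2s : r ^ (2 * s) = L ^ (2 * s / N) * I ^ (2 * s / N) / X ^ (p - 2) := by
    rw [hr, ← Real.rpow_mul (by positivity), ← hpe, Real.rpow_mul hX0.le,
      ← Real.mul_rpow (by positivity) (by positivity), ← Real.div_rpow (by positivity)
      (by positivity)]
    congr 1; ring
  have hball : ∫⁻ y in Metric.ball x r, ENNReal.ofReal (u y ^ 2) ≤
      ENNReal.ofReal ((X / 4) ^ 2 * (ballVol N * r ^ N) + (X / 4) ^ (2 - p) * I) := by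
    calc _ ≤ ∫⁻ y in Metric.ball x r, (ENNReal.ofReal ((X / 4) ^ 2) +
          ENNReal.ofReal ((X / 4) ^ (2 - p)) * ENNReal.ofReal (|u y| ^ p)) := by
          refine lintegral_mono fun y => ?_
          rw [← ENNReal.ofReal_mul (by positivity), ← ENNReal.ofReal_add (by positivity)
            (by positivity), ← sq_abs]
          exact ENNReal.ofReal_le_ofReal (sq_le_add_rpow hp.le (by positivity) (abs_nonneg _))
      _ = ENNReal.ofReal ((X / 4) ^ 2) * ENNReal.ofReal (ballVol N * r ^ N) +
          ENNReal.ofReal ((X / 4) ^ (2 - p)) *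
            ∫⁻ y in Metric.ball x r, ENNReal.ofReal (|u y| ^ p) := by
          rw [lintegral_add_left measurable_const, setLIntegral_const, volume_ball_eq x hr0,
            lintegral_const_mul _ (by fun_prop)]
      _ ≤ ENNReal.ofReal ((X / 4) ^ 2) * ENNReal.ofReal (ballVol N * r ^ N) +
          ENNReal.ofReal ((X / 4) ^ (2 - p)) * ENNReal.ofReal I := by
          gcongr
          exact (setLIntegral_le_lintegral _ _).trans huI
      _ = _ := by
          rw [← ENNReal.ofReal_mul (by positivity), ← ENNReal.ofReal_mul (by positivity),
            ← ENNReal.ofReal_add (by positivity) (by positivity)]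
  have key := sq_mul_ballVol_le hs hu hr0 (by positivity) hD hball
  set d := (gagliardoDensity N s u x).toReal with hd
  have hd0 : 0 ≤ d := ENNReal.toReal_nonneg
  rw [← ENNReal.ofReal_toReal hD, ← ENNReal.ofReal_mul (by positivity)]
  refine ENNReal.ofReal_le_ofReal ?_
  rw [← sq_abs, ← hX, Real.rpow_add hr0, Real.rpow_natCast] at key
  have h4 : (X / 4) ^ (2 - p) * I = ballVol N * r ^ N * X ^ 2 / 8 := by
    have e1 : (X / 4) ^ (2 - p) = X ^ 2 / X ^ p * 4 ^ (p - 2) := by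
      rw [Real.div_rpow hX0.le (by norm_num), Real.rpow_sub hX0, Real.rpow_two,
        show p - 2 = -(2 - p) by ring, Real.rpow_neg (by norm_num : (0 : ℝ) ≤ 4)]
      field_simp
    rw [e1, hrN, hL]
    field_simp
  rw [h4] at key
  have hrpos : 0 < r ^ N := by positivity
  -- Twice the ball mass is `3/8` of the left side of `key` and is absorbed there.
  have h5 : ballVol N * X ^ 2 ≤ 4 * (r ^ (2 * s) * d) := by
    refine le_of_mul_le_mul_left ?_ hrpos
    have : 0 ≤ r ^ N * (ballVol N * X ^ 2) := by positivity
    nlinarith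
  have h6 : X ^ p = X ^ 2 * X ^ (p - 2) := by
    rw [← Real.rpow_two, ← Real.rpow_add hX0]; congr 1; ring
  have h7 : 0 < X ^ (p - 2) := by positivity
  rw [hr2s] at h5
  rw [h6]
  have h8 : X ^ 2 ≤ 4 * (L ^ (2 * s / N) * I ^ (2 * s / N) / X ^ (p - 2) * d) / ballVol N := by
    rw [le_div_iff₀ hω]; linarith
  calc X ^ 2 * X ^ (p - 2) ≤ _ := mul_le_mul_of_nonneg_right h8 h7.le
    _ = _ := by rw [hd]; field_simp

/-- The fractional Sobolev inequality for functions which are known to be in `L^p`. -/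
theorem exists_sobolev_of_lt_top (hs : 0 < s) (hN : 2 * s < (N : ℝ)) :
    ∃ c : ℝ, 0 < c ∧ ∀ (u : E N → ℝ), Measurable u → ∀ g : ℝ, 0 ≤ g →
      ∫⁻ x, gagliardoDensity N s u x ≤ ENNReal.ofReal g →
      ∫⁻ y, ENNReal.ofReal (|u y| ^ critExp N s) < ⊤ →
      ∫⁻ y, ENNReal.ofReal (|u y| ^ critExp N s) ≤
        ENNReal.ofReal ((c * g) ^ (critExp N s / 2)) := by
  obtain ⟨c, hc, h⟩ := exists_rpow_le_gagliardoDensity (N := N) hs hN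
  have hN0 : (0 : ℝ) < N := by linarith
  refine ⟨c, hc, fun u hu g hg hug hI => ?_⟩
  set I := (∫⁻ y, ENNReal.ofReal (|u y| ^ critExp N s)).toReal with hId
  have hIe : ∫⁻ y, ENNReal.ofReal (|u y| ^ critExp N s) = ENNReal.ofReal I :=
    (ENNReal.ofReal_toReal hI.ne).symm
  rw [hIe]
  refine ENNReal.ofReal_le_ofReal ?_
  rcases (ENNReal.toReal_nonneg : 0 ≤ I).eq_or_lt with h0 | h0
  · exact h0.symm.le.trans (by positivity)
  have hm : Measurable (gagliardoDensity N s u) :=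
    (measurable_diffQuot_sq hu).lintegral_prod_right'
  have h1 : ENNReal.ofReal I ≤ ENNReal.ofReal (c * I ^ (2 * s / N) * g) := by
    rw [ENNReal.ofReal_mul (p := c * I ^ (2 * s / N)) (by positivity)]
    calc ENNReal.ofReal I = ∫⁻ y, ENNReal.ofReal (|u y| ^ critExp N s) := hIe.symm
      _ ≤ ∫⁻ x, ENNReal.ofReal (c * I ^ (2 * s / N)) * gagliardoDensity N s u x :=
        lintegral_mono (h u hu I h0 hIe.le)
      _ = ENNReal.ofReal (c * I ^ (2 * s / N)) * ∫⁻ x, gagliardoDensity N s u x :=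
        lintegral_const_mul _ hm
      _ ≤ _ := by gcongr
  have h2 := (ENNReal.ofReal_le_ofReal_iff (by positivity)).1 h1
  -- Here `I` must be finite and positive to be cancelled; the remaining exponent `1 - 2s/N` is `2 /
  -- critExp N s`.
  have h3 : I ^ (1 - 2 * s / N) ≤ c * g := by
    rw [Real.rpow_sub h0, Real.rpow_one, div_le_iff₀ (by positivity)]
    linarith
  have hcr : (1 - 2 * s / N) * (critExp N s / 2) = 1 := by
    have : (N : ℝ) - 2 * s ≠ 0 := by linarith
    rw [critExp]; field_simp
  have h4 : 0 ≤ critExp N s / 2 := by linarith [two_lt_critExp hs hN]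
  calc I = (I ^ (1 - 2 * s / N)) ^ (critExp N s / 2) := by
        rw [← Real.rpow_mul h0.le, hcr, Real.rpow_one]
    _ ≤ _ := Real.rpow_le_rpow (by positivity) h3 h4

theorem gagliardoDensity_mono {u w : E N → ℝ} (h : ∀ x y, |w x - w y| ≤ |u x - u y|) (x : E N) :
    gagliardoDensity N s w x ≤ gagliardoDensity N s u x := by
  refine lintegral_mono fun y => ENNReal.ofReal_le_ofReal ?_
  have := h x y
  gcongr

/-- The fractional Sobolev inequality. -/
theorem exists_sobolev (hs : 0 < s) (hN : 2 * s < (N : ℝ)) :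
    ∃ c : ℝ, 0 < c ∧ ∀ (u : E N → ℝ), Measurable u → ∀ g : ℝ, 0 ≤ g →
      ∫⁻ x, gagliardoDensity N s u x ≤ ENNReal.ofReal g →
      ∫⁻ y, ENNReal.ofReal (u y ^ 2) < ⊤ →
      ∫⁻ y, ENNReal.ofReal (|u y| ^ critExp N s) ≤
        ENNReal.ofReal ((c * g) ^ (critExp N s / 2)) := by
  obtain ⟨c, hc, h⟩ := exists_sobolev_of_lt_top (N := N) hs hN
  have hp := two_lt_critExp hs hN
  refine ⟨c, hc, fun u hu g hg hug h2 => ?_⟩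
  -- Truncation removes the assumption `u ∈ L^p`: each `w k` is in `L^p` because `w^p ≤ k^(p-2) u²`,
  -- does not increase the Gagliardo density, and increases to `|u|`.
  set w : ℕ → E N → ℝ := fun k x => min |u x| k with hw
  have hwm : ∀ k, Measurable (w k) := fun k => (measurable_norm.comp hu).min measurable_const
  have hw0 : ∀ k x, 0 ≤ w k x := fun k x => le_min (abs_nonneg _) (Nat.cast_nonneg _)
  have hwa : ∀ k x, |w k x| = w k x := fun k x => abs_of_nonneg (hw0 k x)
  have hlim : Tendsto (fun k => ∫⁻ y, ENNReal.ofReal (|w k y| ^ critExp N s)) atTop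
      (𝓝 (∫⁻ y, ENNReal.ofReal (|u y| ^ critExp N s))) := by
    refine lintegral_tendsto_of_tendsto_of_monotone
      (fun k => ((measurable_norm.comp (hwm k)).pow_const _).ennreal_ofReal.aemeasurable)
      (Eventually.of_forall fun x k l hkl => ?_) (Eventually.of_forall fun x => ?_)
    · refine ENNReal.ofReal_le_ofReal (Real.rpow_le_rpow (abs_nonneg _) ?_ (by linarith))
      rw [hwa, hwa]
      exact min_le_min le_rfl (by exact_mod_cast hkl)
    · refine tendsto_const_nhds.congr' ?_
      obtain ⟨n, hn⟩ := exists_nat_ge |u x|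
      filter_upwards [eventually_ge_atTop n] with k hk
      rw [hwa, hw]
      simp only
      rw [min_eq_left (hn.trans (by exact_mod_cast hk))]
  refine le_of_tendsto' hlim fun k => h (w k) (hwm k) g hg ?_ ?_
  · refine (lintegral_mono fun x => gagliardoDensity_mono (fun x y => ?_) x).trans hug
    have h1 : |w k x - w k y| ≤ max |(|u x| - |u y|)| |(k : ℝ) - k| :=
      abs_min_sub_min_le_max _ _ _ _
    rw [sub_self, abs_zero, max_eq_left (abs_nonneg _)] at h1
    exact h1.trans (abs_abs_sub_abs_le_abs_sub _ _)
  · calc ∫⁻ y, ENNReal.ofReal (|w k y| ^ critExp N s)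
        ≤ ∫⁻ y, ENNReal.ofReal ((k : ℝ) ^ (critExp N s - 2)) * ENNReal.ofReal (u y ^ 2) := by
          refine lintegral_mono fun y => ?_
          rw [← ENNReal.ofReal_mul (by positivity), hwa]
          refine ENNReal.ofReal_le_ofReal ?_
          have e0 := hw0 k y
          have e1 : w k y ^ critExp N s = w k y ^ (critExp N s - 2) * w k y ^ 2 := by
            rcases e0.eq_or_lt with e | e
            · rw [← e, Real.zero_rpow (by linarith)]; simp
            · rw [← Real.rpow_two, ← Real.rpow_add e]; congr 1; ring
          rw [e1, ← sq_abs (u y)]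
          have e2 : w k y ≤ k := min_le_right _ _
          have e3 : w k y ≤ |u y| := min_le_left _ _
          have e4 : w k y ^ (critExp N s - 2) ≤ (k : ℝ) ^ (critExp N s - 2) :=
            Real.rpow_le_rpow e0 e2 (by linarith)
          gcongr
      _ = ENNReal.ofReal ((k : ℝ) ^ (critExp N s - 2)) * ∫⁻ y, ENNReal.ofReal (u y ^ 2) :=
          lintegral_const_mul _ (hu.pow_const 2).ennreal_ofReal
      _ < ⊤ := ENNReal.mul_lt_top ENNReal.ofReal_lt_top h2

/-- If no unit ball carries much mass, then little mass lies where `u` is not small. -/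
theorem lintegral_sq_tail_le (hs : 0 < s) {u : E N → ℝ} (hu : Measurable u) {a r : ℝ}
    (ha : 0 < a) (hr : 0 < r) (hr1 : r ≤ 1)
    (h : ∀ y, ∫⁻ x in Metric.ball y 1, ENNReal.ofReal (u x ^ 2) ≤
      ENNReal.ofReal (ballVol N * r ^ N * a ^ 2 / 4)) :
    ∫⁻ x in {x | a < |u x|}, ENNReal.ofReal (u x ^ 2) ≤
      ENNReal.ofReal (4 / ballVol N * r ^ (2 * s)) * ∫⁻ x, gagliardoDensity N s u x := by
  have hω := ballVol_pos N
  have hm : Measurable (gagliardoDensity N s u) :=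
    (measurable_diffQuot_sq hu).lintegral_prod_right'
  rw [← lintegral_const_mul _ hm]
  refine (setLIntegral_mono' (measurableSet_lt measurable_const (measurable_norm.comp hu))
    fun x hx => ?_).trans (setLIntegral_le_lintegral _ _)
  rcases eq_or_ne (gagliardoDensity N s u x) ⊤ with hD | hD
  · rw [hD, ENNReal.mul_top]
    · exact le_top
    · rw [Ne, ENNReal.ofReal_eq_zero, not_le]; positivity
  have hb : ∫⁻ y in Metric.ball x r, ENNReal.ofReal (u y ^ 2) ≤
      ENNReal.ofReal (ballVol N * r ^ N * a ^ 2 / 4) :=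
    (lintegral_mono_set (Metric.ball_subset_ball hr1)).trans (h x)
  have key := sq_mul_ballVol_le hs hu hr (by positivity) hD hb
  rw [← ENNReal.ofReal_toReal hD, ← ENNReal.ofReal_mul (by positivity)]
  refine ENNReal.ofReal_le_ofReal ?_
  set d := (gagliardoDensity N s u x).toReal with hd
  rw [Real.rpow_add hr, Real.rpow_natCast] at key
  have hax : a ^ 2 ≤ u x ^ 2 := by
    rw [← sq_abs (u x)]; have : a < |u x| := hx
    gcongr
  have hrN : 0 < ballVol N * r ^ N := by positivity
  have h1 : ballVol N * r ^ N * a ^ 2 ≤ ballVol N * r ^ N * u x ^ 2 := by gcongr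
  -- Where `|u x| > a`, the assumed ball mass accounts for at most half of the left side of `key`.
  have h2 : ballVol N * r ^ N * u x ^ 2 ≤
      ballVol N * r ^ N * (4 / ballVol N * r ^ (2 * s) * d) := by
    have : ballVol N * r ^ N * (4 / ballVol N * r ^ (2 * s) * d) =
      4 * (r ^ N * r ^ (2 * s) * d) := by field_simp
    rw [this]; nlinarith
  exact le_of_mul_le_mul_left h2 hrN

end FracSchrodinger

/-! ### Integral functionals on the fractional Sobolev space and differentiability of the energy -/

namespace FracSchrodinger

variable {N : ℕ} {s : ℝ} {f : E N → ℝ → ℝ} {V : E N → ℝ}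

theorem rpow_sub_one_mul_self {q a : ℝ} (hq : 0 < q) (ha : 0 ≤ a) : a ^ (q - 1) * a = a ^ q := by
  rcases ha.eq_or_lt with rfl | h
  · simp [Real.zero_rpow hq.ne']
  · rw [← Real.rpow_add_one h.ne']; simp

/-- The integrand `t² + |t|^q`. -/
noncomputable def mass (q t : ℝ) : ℝ := t ^ 2 + |t| ^ q

/-- The growth rate `|t| + |t|^(q - 1)`. -/
noncomputable def growth (q t : ℝ) : ℝ := |t| + |t| ^ (q - 1)

theorem mass_nonneg (q t : ℝ) : 0 ≤ mass q t := by unfold mass; positivity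

theorem growth_nonneg (q t : ℝ) : 0 ≤ growth q t := by unfold growth; positivity

theorem growth_mul_abs_self {q : ℝ} (hq : 0 < q) (t : ℝ) : growth q t * |t| = mass q t := by
  rw [growth, mass, add_mul, rpow_sub_one_mul_self hq (abs_nonneg t), ← sq, sq_abs]

theorem growth_mono {q : ℝ} (hq : 1 ≤ q) {a b : ℝ} (h : |a| ≤ |b|) : growth q a ≤ growth q b :=
  add_le_add h (Real.rpow_le_rpow (abs_nonneg _) h (by linarith))

/-- Replace the smaller of `|a|`, `|b|` by the larger, using monotonicity of `growth`. This plays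
the role of the Young and Hölder inequalities. -/
theorem growth_mul_abs_le {q : ℝ} (hq : 1 ≤ q) (a b : ℝ) :
    growth q a * |b| ≤ mass q a + mass q b := by
  have ha := mass_nonneg q a
  have hb := mass_nonneg q b
  rcases le_total |a| |b| with h | h
  · have : growth q a * |b| ≤ growth q b * |b| := by gcongr; exact growth_mono hq h
    linarith [growth_mul_abs_self (by linarith : 0 < q) b]
  · have := growth_nonneg q a
    have : growth q a * |b| ≤ growth q a * |a| := by gcongr
    linarith [growth_mul_abs_self (by linarith : 0 < q) a]

namespace Hs

theorem measurable (u : Hs N s) : Measurable u := (Lp.stronglyMeasurable (toL2 u)).measurable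

theorem integrable_sq (u : Hs N s) : Integrable fun x => u x ^ 2 :=
  (Lp.memLp (toL2 u)).integrable_sq

theorem coe_add (u w : Hs N s) : ⇑(toL2 (u + w)) =ᵐ[volume] fun x => u x + w x := by
  rw [map_add]; exact Lp.coeFn_add _ _

theorem coe_smul (a : ℝ) (u : Hs N s) : ⇑(toL2 (a • u)) =ᵐ[volume] fun x => a * u x := by
  rw [map_smul]; exact Lp.coeFn_smul _ _

theorem norm_sq (u : Hs N s) : ‖u‖ ^ 2 = ‖quot u‖ ^ 2 + ∫ x, u x ^ 2 := by
  have h : 0 ≤ ∫ x, u x ^ 2 := integral_nonneg fun x => sq_nonneg _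
  rw [norm_def, ← norm_quot_sq, Real.sq_sqrt (by positivity)]

theorem integral_sq_le (u : Hs N s) : ∫ x, u x ^ 2 ≤ ‖u‖ ^ 2 := by
  rw [norm_sq]; linarith [sq_nonneg ‖quot u‖]

theorem gagliardoSq_le (u : Hs N s) : gagliardoSq N s u ≤ ‖u‖ ^ 2 := by
  have h : 0 ≤ ∫ x, u x ^ 2 := integral_nonneg fun x => sq_nonneg _
  rw [norm_sq, norm_quot_sq]; linarith

theorem norm_quot_le (u : Hs N s) : ‖quot u‖ ≤ ‖u‖ := by
  refine (pow_le_pow_iff_left₀ (norm_nonneg _) (norm_nonneg _) two_ne_zero).1 ?_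
  rw [norm_quot_sq]; exact gagliardoSq_le u

theorem lintegral_gagliardoDensity (u : Hs N s) :
    ∫⁻ x, gagliardoDensity N s u x = ENNReal.ofReal (gagliardoSq N s u) := by
  have hi : Integrable fun p : E N × E N =>
      |u p.1 - u p.2| ^ 2 / ‖p.1 - p.2‖ ^ ((N : ℝ) + 2 * s) := by
    simpa only [diffQuot_sq] using (memLp_diffQuot u).integrable_sq
  rw [gagliardoSq, ofReal_integral_eq_lintegral_ofReal hi
    (Eventually.of_forall fun p => by positivity), Measure.volume_eq_prod,
    lintegral_prod _ (measurable_diffQuot_sq u.measurable).aemeasurable]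
  rfl

theorem lintegral_sq (u : Hs N s) :
    ∫⁻ x, ENNReal.ofReal (u x ^ 2) = ENNReal.ofReal (∫ x, u x ^ 2) :=
  (ofReal_integral_eq_lintegral_ofReal u.integrable_sq
    (Eventually.of_forall fun _ => sq_nonneg _)).symm

/-- The Sobolev embedding of `H^s` into `L² ∩ L^p` with the critical exponent `p`. -/
theorem exists_integral_mass_le (hs : 0 < s) (hN : 2 * s < (N : ℝ)) :
    ∃ K : ℝ, 0 ≤ K ∧ ∀ u : Hs N s, Integrable (fun x => mass (critExp N s) (u x)) ∧
      ∫ x, mass (critExp N s) (u x) ≤ ‖u‖ ^ 2 + K * ‖u‖ ^ critExp N s := by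
  obtain ⟨c, hc, h⟩ := exists_sobolev (N := N) hs hN
  have hp := two_lt_critExp hs hN
  refine ⟨c ^ (critExp N s / 2), by positivity, fun u => ?_⟩
  have hb := h u u.measurable (‖u‖ ^ 2) (sq_nonneg _)
    ((lintegral_gagliardoDensity u).le.trans (ENNReal.ofReal_le_ofReal (gagliardoSq_le u)))
    (by rw [lintegral_sq]; exact ENNReal.ofReal_lt_top)
  have e : (c * ‖u‖ ^ 2) ^ (critExp N s / 2) = c ^ (critExp N s / 2) * ‖u‖ ^ critExp N s := by
    rw [Real.mul_rpow hc.le (sq_nonneg _), ← Real.rpow_two, ← Real.rpow_mul (norm_nonneg _)]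
    congr 2; ring
  rw [e] at hb
  have hm : Measurable fun x => |u x| ^ critExp N s :=
    (measurable_norm.comp u.measurable).pow_const _
  have hnn : ∀ x, 0 ≤ |u x| ^ critExp N s := fun x => by positivity
  have hi : Integrable fun x => |u x| ^ critExp N s := by
    refine ⟨hm.aestronglyMeasurable, ?_⟩
    rw [hasFiniteIntegral_iff_ofReal (Eventually.of_forall hnn)]
    exact hb.trans_lt ENNReal.ofReal_lt_top
  refine ⟨u.integrable_sq.add hi, ?_⟩
  simp only [mass]
  rw [integral_add u.integrable_sq hi]
  refine add_le_add u.integral_sq_le ?_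
  rw [integral_eq_lintegral_of_nonneg_ae (Eventually.of_forall hnn) hm.aestronglyMeasurable]
  exact ENNReal.toReal_le_of_le_ofReal (by positivity) hb

theorem integrable_mass (hs : 0 < s) (hN : 2 * s < (N : ℝ)) (u : Hs N s) :
    Integrable (fun x => mass (critExp N s) (u x)) := by
  obtain ⟨K, -, h⟩ := exists_integral_mass_le (N := N) hs hN
  exact (h u).1

/-- Superposition with a function of growth `t² + |t|^p` maps `H^s` into `L¹`. -/
theorem integrable_comp (hs : 0 < s) (hN : 2 * s < (N : ℝ)) {P : E N → ℝ → ℝ}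
    (hc : Continuous (fun q : E N × ℝ => P q.1 q.2))
    (hP : ∃ C, ∀ x t, |P x t| ≤ C * mass (critExp N s) t) (u : Hs N s) :
    Integrable fun x => P x (u x) := by
  obtain ⟨C, hC⟩ := hP
  have hm : Measurable fun x => P x (u x) := hc.measurable.comp (measurable_id.prodMk u.measurable)
  exact ((integrable_mass hs hN u).const_mul C).mono' hm.aestronglyMeasurable
    (Eventually.of_forall fun x => hC x (u x))

theorem integrable_growth_mul (hs : 0 < s) (hN : 2 * s < (N : ℝ)) (u h : Hs N s) :
    Integrable fun x => growth (critExp N s) (u x) * |h x| := by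
  have hp := two_lt_critExp hs hN
  have hm : Measurable fun x => growth (critExp N s) (u x) * |h x| := by
    have h1 : Measurable fun x => |u x| := measurable_norm.comp u.measurable
    have h2 : Measurable fun x => |h x| := measurable_norm.comp h.measurable
    exact (h1.add (h1.pow_const _)).mul h2
  refine ((integrable_mass hs hN u).add (integrable_mass hs hN h)).mono' hm.aestronglyMeasurable
    (Eventually.of_forall fun x => ?_)
  rw [Real.norm_eq_abs, abs_of_nonneg (mul_nonneg (growth_nonneg _ _) (abs_nonneg _))]
  exact growth_mul_abs_le (by linarith) _ _

/-- The bound `growth_mul_abs_le` is not homogeneous in `h`, so it is applied to `h / ‖h‖`, whose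
total mass is at most `1 + K`, and then rescaled. -/
theorem exists_integral_growth_mul_le (hs : 0 < s) (hN : 2 * s < (N : ℝ)) (u : Hs N s) :
    ∃ B : ℝ, 0 ≤ B ∧ ∀ h : Hs N s, ∫ x, growth (critExp N s) (u x) * |h x| ≤ B * ‖h‖ := by
  have hp := two_lt_critExp hs hN
  obtain ⟨K, hK, hKu⟩ := exists_integral_mass_le (N := N) hs hN
  have hB : 0 ≤ ∫ x, mass (critExp N s) (u x) := integral_nonneg fun x => mass_nonneg _ _
  refine ⟨(∫ x, mass (critExp N s) (u x)) + (1 + K), by positivity, fun h => ?_⟩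
  rcases eq_or_ne h 0 with rfl | h0
  · have : (fun x => growth (critExp N s) (u x) * |(0 : Hs N s) x|) =ᵐ[volume] fun _ => 0 := by
      have h1 := coe_smul 0 (0 : Hs N s)
      rw [zero_smul] at h1
      filter_upwards [h1] with x hx
      rw [hx]; simp
    rw [integral_congr_ae this]; simp
  · have hn : 0 < ‖h‖ := norm_pos_iff.2 h0
    set g : Hs N s := ‖h‖⁻¹ • h with hg
    have hgn : ‖g‖ = 1 := by
      rw [hg, norm_smul, norm_inv, norm_norm, inv_mul_cancel₀ hn.ne']
    have e1 : ∫ x, growth (critExp N s) (u x) * |h x| =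
        ‖h‖ * ∫ x, growth (critExp N s) (u x) * |g x| := by
      rw [← integral_const_mul]
      refine integral_congr_ae ?_
      filter_upwards [coe_smul ‖h‖⁻¹ h] with x hx
      rw [hx, abs_mul, abs_of_pos (inv_pos.2 hn)]
      field_simp
    have e2 : ∫ x, growth (critExp N s) (u x) * |g x| ≤
        ∫ x, (mass (critExp N s) (u x) + mass (critExp N s) (g x)) :=
      integral_mono (integrable_growth_mul hs hN u g)
        ((integrable_mass hs hN u).add (integrable_mass hs hN g))
        fun x => growth_mul_abs_le (by linarith) _ _
    rw [integral_add (integrable_mass hs hN u) (integrable_mass hs hN g)] at e2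
    have e3 := (hKu g).2
    rw [hgn, Real.one_rpow] at e3
    rw [e1, mul_comm]
    gcongr
    linarith

/-- Integral functionals with critical growth are Fréchet differentiable on `H^s`. -/
theorem exists_hasFDerivAt_integral (hs : 0 < s) (hN : 2 * s < (N : ℝ)) {P p : E N → ℝ → ℝ}
    (hPc : Continuous (fun q : E N × ℝ => P q.1 q.2))
    (hpc : Continuous (fun q : E N × ℝ => p q.1 q.2))
    (hP : ∃ C, ∀ x t, |P x t| ≤ C * mass (critExp N s) t)
    (hp : ∃ C, 0 ≤ C ∧ ∀ x t, |p x t| ≤ C * growth (critExp N s) t)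
    (hR : ∀ ε : ℝ, 0 < ε → ∃ C, 0 ≤ C ∧ ∀ x t h, |P x (t + h) - P x t - p x t * h| ≤
      ε * (growth (critExp N s) t * |h|) + C * mass (critExp N s) h) (u : Hs N s) :
    ∃ L : Hs N s →L[ℝ] ℝ, HasFDerivAt (fun w : Hs N s => ∫ x, P x (w x)) L u ∧
      ∀ h, L h = ∫ x, p x (u x) * h x := by
  have hcr := two_lt_critExp hs hN
  obtain ⟨B, hB, hBh⟩ := exists_integral_growth_mul_le hs hN u
  obtain ⟨K, hK, hKu⟩ := exists_integral_mass_le (N := N) hs hN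
  obtain ⟨C, hC0, hC⟩ := hp
  have hpm : Measurable fun x => p x (u x) :=
    hpc.measurable.comp (measurable_id.prodMk u.measurable)
  have hb : ∀ (h : Hs N s) x, ‖p x (u x) * h x‖ ≤ C * (growth (critExp N s) (u x) * |h x|) :=
    fun h x => by
      rw [Real.norm_eq_abs, abs_mul, ← mul_assoc]
      exact mul_le_mul_of_nonneg_right (hC _ _) (abs_nonneg _)
  have hpi : ∀ h : Hs N s, Integrable fun x => p x (u x) * h x := fun h =>
    ((integrable_growth_mul hs hN u h).const_mul C).mono'
      (hpm.mul h.measurable).aestronglyMeasurable (Eventually.of_forall (hb h))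
  let L₀ : Hs N s →ₗ[ℝ] ℝ :=
    { toFun := fun h => ∫ x, p x (u x) * h x
      map_add' := fun h k => by
        rw [← integral_add (hpi h) (hpi k)]
        refine integral_congr_ae ?_
        filter_upwards [coe_add h k] with x hx
        rw [hx]; ring
      map_smul' := fun a h => by
        rw [RingHom.id_apply, smul_eq_mul, ← integral_const_mul]
        refine integral_congr_ae ?_
        filter_upwards [coe_smul a h] with x hx
        rw [hx]; ring }
  refine ⟨L₀.mkContinuous (C * B) fun h => ?_, ?_, fun h => rfl⟩
  · calc ‖∫ x, p x (u x) * h x‖ ≤ ∫ x, C * (growth (critExp N s) (u x) * |h x|) :=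
          norm_integral_le_of_norm_le ((integrable_growth_mul hs hN u h).const_mul C)
            (Eventually.of_forall (hb h))
      _ ≤ C * B * ‖h‖ := by
          rw [integral_const_mul, mul_assoc]
          gcongr
          exact hBh h
  · rw [hasFDerivAt_iff_isLittleO_nhds_zero, Asymptotics.isLittleO_iff]
    intro ε hε
    -- Half of `ε` pays for the term linear in `h`. The other half pays for the mass of `h`, which
    -- is at most `(1 + K) ‖h‖²` when `‖h‖ ≤ 1` because the critical exponent exceeds `2`.
    obtain ⟨D, hD, hDR⟩ := hR (ε / (2 * (B + 1))) (by positivity)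
    have hδ : 0 < min 1 (ε / (2 * (D * (1 + K) + 1))) := by positivity
    filter_upwards [Metric.ball_mem_nhds (0 : Hs N s) hδ] with h hh
    rw [mem_ball_zero_iff] at hh
    have hh1 : ‖h‖ ≤ 1 := (hh.trans_le (min_le_left _ _)).le
    have hh2 : ‖h‖ ≤ ε / (2 * (D * (1 + K) + 1)) := (hh.trans_le (min_le_right _ _)).le
    have iP : ∀ w : Hs N s, Integrable fun x => P x (w x) := integrable_comp hs hN hPc hP
    have e1 : (∫ x, P x ((u + h) x)) - (∫ x, P x (u x)) - ∫ x, p x (u x) * h x =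
        ∫ x, (P x ((u + h) x) - P x (u x) - p x (u x) * h x) := by
      have i3 : Integrable fun x => P x ((u + h) x) - P x (u x) := (iP _).sub (iP _)
      rw [integral_sub i3 (hpi h), integral_sub (iP _) (iP _)]
    change ‖(∫ x, P x ((u + h) x)) - (∫ x, P x (u x)) - ∫ x, p x (u x) * h x‖ ≤ ε * ‖h‖
    rw [e1]
    have i1 := (integrable_growth_mul hs hN u h).const_mul (ε / (2 * (B + 1)))
    have i2 := (integrable_mass hs hN h).const_mul D
    calc _ ≤ ∫ x, (ε / (2 * (B + 1)) * (growth (critExp N s) (u x) * |h x|) +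
          D * mass (critExp N s) (h x)) := by
          refine norm_integral_le_of_norm_le (i1.add i2) ?_
          filter_upwards [coe_add u h] with x hx
          rw [hx]
          exact hDR x (u x) (h x)
      _ = ε / (2 * (B + 1)) * (∫ x, growth (critExp N s) (u x) * |h x|) +
          D * ∫ x, mass (critExp N s) (h x) := by
          rw [integral_add i1 i2, integral_const_mul, integral_const_mul]
      _ ≤ ε / (2 * (B + 1)) * (B * ‖h‖) + D * ((1 + K) * ‖h‖ ^ 2) := by
          gcongr
          · exact hBh h
          · refine (hKu h).2.trans ?_
            have : ‖h‖ ^ critExp N s ≤ ‖h‖ ^ (2 : ℝ) :=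
              Real.rpow_le_rpow_of_exponent_ge_of_imp (norm_nonneg _) hh1 hcr.le
                (fun _ h2 => absurd h2 (by linarith))
            rw [Real.rpow_two] at this
            nlinarith
      _ ≤ ε / 2 * ‖h‖ + ε / 2 * ‖h‖ := by
          refine add_le_add ?_ ?_
          · rw [← mul_assoc]
            gcongr
            rw [div_mul_eq_mul_div, div_le_div_iff₀ (by positivity) two_pos]
            nlinarith
          · have h3 : (D * (1 + K)) * ‖h‖ ≤ ε / 2 := by
              rw [le_div_iff₀ (by positivity)] at hh2
              nlinarith [norm_nonneg h]
            calc D * ((1 + K) * ‖h‖ ^ 2) = ((D * (1 + K)) * ‖h‖) * ‖h‖ := by ring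
              _ ≤ _ := by gcongr
      _ = ε * ‖h‖ := by ring

/-- `quot` as a continuous linear map. -/
noncomputable def quotL : Hs N s →L[ℝ] Lp ℝ 2 (volume : Measure (E N × E N)) :=
  quot.mkContinuous 1 fun u => by rw [one_mul]; exact norm_quot_le u

end Hs

open Hs

theorem CondF1.continuous (hf1 : CondF1 s f) : Continuous (fun p : E N × ℝ => f p.1 p.2) := hf1.1

theorem exists_abs_le_growth (hf1 : CondF1 s f) (hf2 : CondF2 f) :
    ∃ C, 0 ≤ C ∧ ∀ x t, |f x t| ≤ C * growth (critExp N s) t := by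
  obtain ⟨C, hC0, hC⟩ := exists_le_add_linear hf1 hf2 one_pos
  refine ⟨1 + C, by positivity, fun x t => (hC x t).trans ?_⟩
  have h1 : 0 ≤ |t| ^ (critExp N s - 1) := by positivity
  have h2 := abs_nonneg t
  rw [growth]
  nlinarith [mul_nonneg hC0 h1]

theorem exists_abs_primitive_le_mass (hs : 0 < s) (hN : 2 * s < (N : ℝ)) (hf1 : CondF1 s f)
    (hf2 : CondF2 f) : ∃ C, 0 ≤ C ∧ ∀ x t, |primitive f x t| ≤ C * mass (critExp N s) t := by
  obtain ⟨C, hC0, hC⟩ := exists_abs_primitive_le hs hN hf1 hf2 one_pos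
  refine ⟨1 + C, by positivity, fun x t => (hC x t).trans ?_⟩
  have h1 : 0 ≤ |t| ^ critExp N s := by positivity
  have h2 := sq_nonneg t
  rw [mass]
  nlinarith [mul_nonneg hC0 h1]

theorem integrable_primitive (hs : 0 < s) (hN : 2 * s < (N : ℝ)) (hf1 : CondF1 s f)
    (hf2 : CondF2 f) (u : Hs N s) : Integrable fun x => primitive f x (u x) := by
  obtain ⟨C, -, hC⟩ := exists_abs_primitive_le_mass hs hN hf1 hf2
  exact integrable_comp hs hN (continuous_primitive hf1.1) ⟨C, hC⟩ u

theorem integrable_mul_self (hs : 0 < s) (hN : 2 * s < (N : ℝ)) (hf1 : CondF1 s f)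
    (hf2 : CondF2 f) (u : Hs N s) : Integrable fun x => f x (u x) * u x := by
  obtain ⟨C, -, hC⟩ := exists_abs_le_growth hf1 hf2
  refine integrable_comp hs hN (P := fun x t => f x t * t) (hf1.continuous.mul continuous_snd)
    ⟨C, fun x t => ?_⟩ u
  rw [abs_mul, ← growth_mul_abs_self (by linarith [two_lt_critExp hs hN]), ← mul_assoc]
  exact mul_le_mul_of_nonneg_right (hC x t) (abs_nonneg t)

theorem integrable_gFun (hs : 0 < s) (hN : 2 * s < (N : ℝ)) (hf1 : CondF1 s f)
    (hf2 : CondF2 f) (u : Hs N s) : Integrable fun x => gFun f x (u x) :=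
  (integrable_mul_self hs hN hf1 hf2 u).sub ((integrable_primitive hs hN hf1 hf2 u).const_mul 2)

theorem CondV1.exists_bounds (hV : CondV1 V) :
    ∃ α β : ℝ, 0 < α ∧ 0 < β ∧ ∀ x, α ≤ V x ∧ V x ≤ β := by
  obtain ⟨-, α, β, hα, h⟩ := hV
  exact ⟨α, β, hα, hα.trans_le ((h 0).1.trans (h 0).2), h⟩

theorem CondV1.integrable_mul_sq (hV : CondV1 V) (u : Hs N s) :
    Integrable fun x => V x * u x ^ 2 := by
  obtain ⟨α, β, hα, hβ, h⟩ := hV.exists_bounds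
  refine (u.integrable_sq.const_mul β).mono'
    (hV.1.measurable.mul (u.measurable.pow_const 2)).aestronglyMeasurable
    (Eventually.of_forall fun x => ?_)
  rw [Real.norm_eq_abs, abs_mul, abs_of_nonneg (hα.le.trans (h x).1), abs_of_nonneg (sq_nonneg _)]
  exact mul_le_mul_of_nonneg_right (h x).2 (sq_nonneg _)

/-- The bounds on `V` make the quadratic part comparable to `‖u‖²`. The lower bound serves the
vanishing case, the upper one the concentration case. -/
theorem CondV1.exists_quadratic_bounds (hV : CondV1 V) :
    ∃ a b : ℝ, 0 < a ∧ 0 < b ∧ ∀ u : Hs N s,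
      a * ‖u‖ ^ 2 - ∫ x, primitive f x (u x) ≤ energy V f u ∧
      energy V f u ≤ b * ‖u‖ ^ 2 - ∫ x, primitive f x (u x) := by
  obtain ⟨α, β, hα, hβ, h⟩ := hV.exists_bounds
  refine ⟨min 1 α / 2, max 1 β / 2, by positivity, by positivity, fun u => ?_⟩
  have h1 : α * ∫ x, u x ^ 2 ≤ ∫ x, V x * u x ^ 2 := by
    rw [← integral_const_mul]
    exact integral_mono (u.integrable_sq.const_mul α) (hV.integrable_mul_sq u)
      fun x => mul_le_mul_of_nonneg_right (h x).1 (sq_nonneg _)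
  have h2 : ∫ x, V x * u x ^ 2 ≤ β * ∫ x, u x ^ 2 := by
    rw [← integral_const_mul]
    exact integral_mono (hV.integrable_mul_sq u) (u.integrable_sq.const_mul β)
      fun x => mul_le_mul_of_nonneg_right (h x).2 (sq_nonneg _)
  have h3 : 0 ≤ ∫ x, u x ^ 2 := integral_nonneg fun x => sq_nonneg _
  have h4 := sq_nonneg ‖quot u‖
  rw [energy, norm_sq, ← norm_quot_sq]
  have m1 := min_le_left 1 α
  have m2 := min_le_right 1 α
  have m3 := le_max_left 1 β
  have m4 := le_max_right 1 β
  constructor <;> nlinarith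

/-- The energy is Fréchet differentiable, and `2 J(u) - ⟨J'(u), u⟩ = ∫ G(x, u)`. -/
theorem energy_differentiableAt (hs : 0 < s) (hN : 2 * s < (N : ℝ)) (hV : CondV1 V)
    (hf1 : CondF1 s f) (hf2 : CondF2 f) (u : Hs N s) :
    DifferentiableAt ℝ (energy V f) u ∧
      2 * energy V f u - fderiv ℝ (energy V f) u u = ∫ x, gFun f x (u x) := by
  have hcr := two_lt_critExp hs hN
  obtain ⟨α, β, hα, hβ, hVb⟩ := hV.exists_bounds
  have hVa : ∀ x, |V x| ≤ β := fun x => by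
    rw [abs_of_nonneg (hα.le.trans (hVb x).1)]; exact (hVb x).2
  have hVc : Continuous fun q : E N × ℝ => V q.1 := hV.1.comp continuous_fst
  -- The potential term and `F` form one integral functional; the seminorm is left aside, being the
  -- squared Hilbert norm of the linear map `quotL`.
  obtain ⟨L, hL, hLe⟩ := exists_hasFDerivAt_integral hs hN
    (P := fun x t => V x * t ^ 2 / 2 - primitive f x t) (p := fun x t => V x * t - f x t)
    (by exact ((hVc.mul (continuous_snd.pow 2)).div_const 2).sub (continuous_primitive hf1.1))
    (by exact (hVc.mul continuous_snd).sub hf1.continuous)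
    (by
      obtain ⟨C, hC0, hC⟩ := exists_abs_primitive_le_mass hs hN hf1 hf2
      refine ⟨β + C, fun x t => (abs_sub _ _).trans ?_⟩
      have h1 : |V x * t ^ 2 / 2| ≤ β * mass (critExp N s) t := by
        rw [abs_div, abs_mul, abs_of_nonneg (sq_nonneg t), abs_two]
        have : |V x| * t ^ 2 ≤ β * t ^ 2 := mul_le_mul_of_nonneg_right (hVa x) (sq_nonneg _)
        have h2 : t ^ 2 ≤ mass (critExp N s) t := by
          rw [mass]; linarith [Real.rpow_nonneg (abs_nonneg t) (critExp N s)]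
        have h3 : β * t ^ 2 ≤ β * mass (critExp N s) t := by gcongr
        have h4 : 0 ≤ β * t ^ 2 := by positivity
        linarith
      linarith [hC x t])
    (by
      obtain ⟨C, hC0, hC⟩ := exists_abs_le_growth hf1 hf2
      refine ⟨β + C, by positivity, fun x t => (abs_sub _ _).trans ?_⟩
      have h1 : |V x * t| ≤ β * growth (critExp N s) t := by
        rw [abs_mul]
        have h2 : |t| ≤ growth (critExp N s) t := by
          rw [growth]; linarith [Real.rpow_nonneg (abs_nonneg t) (critExp N s - 1)]
        gcongr
        exact hVa x
      linarith [hC x t])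
    (by
      intro ε hε
      obtain ⟨C, hC0, hC⟩ := exists_increment_le hs hN hf1 hf2 hε
      refine ⟨β + C, by positivity, fun x t h => ?_⟩
      have h1 := abs_primitive_sub_le hf1.1 (x := x) (t := t) (h := h) (fun k hk => hC x t h k hk)
      have e1 : V x * (t + h) ^ 2 / 2 - primitive f x (t + h) -
          (V x * t ^ 2 / 2 - primitive f x t) - (V x * t - f x t) * h =
          V x * h ^ 2 / 2 - (primitive f x (t + h) - primitive f x t - f x t * h) := by ring
      rw [e1]
      refine (abs_sub _ _).trans ?_
      have h2 : |V x * h ^ 2 / 2| ≤ β * mass (critExp N s) h := by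
        rw [abs_div, abs_mul, abs_of_nonneg (sq_nonneg h), abs_two]
        have : |V x| * h ^ 2 ≤ β * h ^ 2 := mul_le_mul_of_nonneg_right (hVa x) (sq_nonneg _)
        have h2 : h ^ 2 ≤ mass (critExp N s) h := by
          rw [mass]; linarith [Real.rpow_nonneg (abs_nonneg h) (critExp N s)]
        have h3 : β * h ^ 2 ≤ β * mass (critExp N s) h := by gcongr
        have h4 : 0 ≤ β * h ^ 2 := by positivity
        linarith
      have h3 : (ε * (|t| + |t| ^ (critExp N s - 1)) + C * (|h| + |h| ^ (critExp N s - 1))) * |h| =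
          ε * (growth (critExp N s) t * |h|) + C * mass (critExp N s) h := by
        rw [← growth_mul_abs_self (by linarith : 0 < critExp N s) h]
        simp only [growth]; ring
      rw [h3] at h1
      linarith) u
  have hq : HasFDerivAt (fun w : Hs N s => ‖quotL w‖ ^ 2)
      (2 • (innerSL ℝ (quotL u)).comp quotL) u := quotL.hasFDerivAt.norm_sq
  have hJ : energy V f = fun w : Hs N s => (1 / 2 : ℝ) * ‖quotL w‖ ^ 2 +
      ∫ x, (V x * w x ^ 2 / 2 - primitive f x (w x)) := by
    funext w
    rw [integral_sub ((hV.integrable_mul_sq w).div_const 2) (integrable_primitive hs hN hf1 hf2 w),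
      integral_div, energy, ← norm_quot_sq]
    change _ = (1 / 2 : ℝ) * ‖quot w‖ ^ 2 + _
    ring
  have hd : HasFDerivAt (energy V f)
      ((1 / 2 : ℝ) • (2 • (innerSL ℝ (quotL u)).comp quotL) + L) u := by
    rw [hJ]
    exact (hq.const_mul (1 / 2 : ℝ)).add hL
  refine ⟨hd.differentiableAt, ?_⟩
  have e2 : fderiv ℝ (energy V f) u u = ‖quot u‖ ^ 2 + ∫ x, (V x * u x - f x (u x)) * u x := by
    rw [hd.fderiv, ← hLe, ← real_inner_self_eq_norm_sq]
    simp only [_root_.add_apply, _root_.smul_apply,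
      ContinuousLinearMap.comp_apply, innerSL_apply_apply, smul_eq_mul, nsmul_eq_mul]
    change (1 / 2 : ℝ) * ((2 : ℕ) * inner ℝ (quot u) (quot u)) + L u = _
    push_cast; ring
  have e3 : ∫ x, (V x * u x - f x (u x)) * u x =
      (∫ x, V x * u x ^ 2) - ∫ x, f x (u x) * u x := by
    rw [← integral_sub (hV.integrable_mul_sq u) (integrable_mul_self hs hN hf1 hf2 u)]
    congr 1; funext x; ring
  have e4 : ∫ x, gFun f x (u x) =
      (∫ x, f x (u x) * u x) - 2 * ∫ x, primitive f x (u x) := by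
    rw [← integral_const_mul, ← integral_sub (integrable_mul_self hs hN hf1 hf2 u)
      ((integrable_primitive hs hN hf1 hf2 u).const_mul 2)]
    rfl
  rw [e2, e3, e4, energy, ← norm_quot_sq]
  ring

end FracSchrodinger

/-! ### Vanishing versus concentration -/

namespace FracSchrodinger

open Hs

variable {N : ℕ} {s : ℝ} {f : E N → ℝ → ℝ} {V : E N → ℝ}

/-- If no unit ball carries much mass, the tail of `u` has small mass. -/
theorem Hs.setIntegral_sq_tail_le (hs : 0 < s) (u : Hs N s) {a r : ℝ} (ha : 0 < a) (hr : 0 < r)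
    (hr1 : r ≤ 1)
    (h : ∀ y, ∫ x in Metric.ball y 1, u x ^ 2 ≤ ballVol N * r ^ N * a ^ 2 / 4) :
    ∫ x in {x | a < |u x|}, u x ^ 2 ≤ 4 / ballVol N * r ^ (2 * s) * ‖u‖ ^ 2 := by
  have hω := ballVol_pos N
  have hset : ∀ S : Set (E N), ENNReal.ofReal (∫ x in S, u x ^ 2) =
      ∫⁻ x in S, ENNReal.ofReal (u x ^ 2) := fun S =>
    ofReal_integral_eq_lintegral_ofReal u.integrable_sq.integrableOn
      (Eventually.of_forall fun _ => sq_nonneg _)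
  have h1 := lintegral_sq_tail_le hs u.measurable ha hr hr1 fun y => by
    rw [← hset]; exact ENNReal.ofReal_le_ofReal (h y)
  rw [← hset, lintegral_gagliardoDensity, ← ENNReal.ofReal_mul (by positivity)] at h1
  have hg : 0 ≤ gagliardoSq N s u := by rw [← norm_quot_sq]; positivity
  refine ((ENNReal.ofReal_le_ofReal_iff (by positivity)).1 h1).trans ?_
  have := gagliardoSq_le u
  gcongr

/-- The nonlinear term is small on bounded sets if no unit ball carries much mass. -/
theorem exists_integral_primitive_le_one (hs : 0 < s) (hN : 2 * s < (N : ℝ)) (hf1 : CondF1 s f)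
    (hf2 : CondF2 f) {ρ : ℝ} (hρ : 0 < ρ) :
    ∃ δ : ℝ, 0 < δ ∧ ∀ w : Hs N s, ‖w‖ ≤ ρ → (∀ y, ∫ x in Metric.ball y 1, w x ^ 2 ≤ δ) →
      ∫ x, primitive f x (w x) ≤ 1 := by
  have hω := ballVol_pos N
  have hcr := two_lt_critExp hs hN
  obtain ⟨K, hK, hKu⟩ := exists_integral_mass_le (N := N) hs hN
  set ε : ℝ := 1 / (2 * (ρ ^ 2 + K * ρ ^ critExp N s)) with hεd
  have hε : 0 < ε := by positivity
  obtain ⟨a, ha, hFa⟩ := hf2.exists_abs_primitive_le hf1.1 hε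
  obtain ⟨C, hC0, hC⟩ := exists_abs_primitive_le hs hN hf1 hf2 hε
  -- `X` is the size of `r ^ (2 * s)` for which the tail term, `C` times the bound of
  -- `setIntegral_sq_tail_le`, is at most `1 / 2`; `ε` took care of the other half.
  set X : ℝ := 1 / (2 * (C * (4 / ballVol N) * ρ ^ 2 + 1)) with hXd
  have hX : 0 < X := by positivity
  set r : ℝ := min 1 (X ^ (1 / (2 * s))) with hrd
  have hr : 0 < r := by positivity
  have hrX : r ^ (2 * s) ≤ X := by
    calc r ^ (2 * s) ≤ (X ^ (1 / (2 * s))) ^ (2 * s) :=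
          Real.rpow_le_rpow hr.le (min_le_right _ _) (by positivity)
      _ = X := by
          rw [← Real.rpow_mul hX.le, one_div_mul_cancel (by positivity), Real.rpow_one]
  refine ⟨ballVol N * r ^ N * a ^ 2 / 4, by positivity, fun w hw hwy => ?_⟩
  have htail := setIntegral_sq_tail_le hs w ha hr (min_le_left _ _) hwy
  have hS : MeasurableSet {x | a < |w x|} :=
    measurableSet_lt measurable_const (measurable_norm.comp w.measurable)
  have i1 := (integrable_mass hs hN w).const_mul ε
  have i2 : Integrable ({x | a < |w x|}.indicator fun x => C * w x ^ 2) :=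
    (w.integrable_sq.const_mul C).indicator hS
  have h1 : ∫ x, primitive f x (w x) ≤ ∫ x, (ε * mass (critExp N s) (w x) +
      {x | a < |w x|}.indicator (fun x => C * w x ^ 2) x) := by
    refine integral_mono (integrable_primitive hs hN hf1 hf2 w) (i1.add i2) fun x => ?_
    have hm : mass (critExp N s) (w x) = w x ^ 2 + |w x| ^ critExp N s := rfl
    have hq : 0 ≤ |w x| ^ critExp N s := by positivity
    simp only [hm, mul_add]
    -- Below the threshold `a` the bound from (f2) suffices; above it the full growth bound is used,
    -- so `C w²` enters only on the tail.
    rcases le_or_gt |w x| a with hx | hx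
    · have := mul_nonneg hε.le hq
      rw [Set.indicator_of_notMem (by simpa using hx)]
      linarith [le_abs_self (primitive f x (w x)), hFa x _ hx]
    · have := mul_nonneg hε.le (sq_nonneg (w x))
      rw [Set.indicator_of_mem (by simpa using hx)]
      linarith [le_abs_self (primitive f x (w x)), hC x (w x)]
  rw [integral_add i1 i2, integral_const_mul, integral_indicator hS, integral_const_mul] at h1
  have h2 : ε * ∫ x, mass (critExp N s) (w x) ≤ 1 / 2 := by
    have h3 : ∫ x, mass (critExp N s) (w x) ≤ ρ ^ 2 + K * ρ ^ critExp N s := by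
      refine (hKu w).2.trans ?_
      have := Real.rpow_le_rpow (norm_nonneg w) hw (by linarith : 0 ≤ critExp N s)
      gcongr
    calc _ ≤ ε * (ρ ^ 2 + K * ρ ^ critExp N s) := by gcongr
      _ = 1 / 2 := by rw [hεd]; field_simp
  have h4 : C * ∫ x in {x | a < |w x|}, w x ^ 2 ≤ 1 / 2 := by
    calc _ ≤ C * (4 / ballVol N * X * ρ ^ 2) := by
          refine mul_le_mul_of_nonneg_left (htail.trans ?_) hC0
          gcongr
      _ = C * (4 / ballVol N) * ρ ^ 2 * X := by ring
      _ ≤ 1 / 2 := by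
          rw [hXd, mul_one_div, div_le_div_iff₀ (by positivity) two_pos]
          linarith
  linarith

/-- Functions of bounded below energy which carry a fixed fraction of their mass in a unit ball
are bounded. -/
theorem exists_norm_le_of_concentration (hs : 0 < s) (hN : 2 * s < (N : ℝ)) (hV : CondV1 V)
    (hf1 : CondF1 s f) (hf2 : CondF2 f) (hf3 : CondF3 f) (hf4 : CondF4 f) {δ : ℝ} (hδ : 0 < δ)
    (c : ℝ) : ∃ R : ℝ, ∀ v : Hs N s, c ≤ energy V f v →
      (∃ y, δ * ‖v‖ ^ 2 < ∫ x in Metric.ball y 1, v x ^ 2) → ‖v‖ ≤ R := by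
  obtain ⟨a, b, ha, hb, hab⟩ := hV.exists_quadratic_bounds (f := f) (s := s)
  -- Chosen so that `M * δ = b + 1`: the ball then contributes `-(b + 1)‖v‖²` against `b‖v‖²`,
  -- leaving `c ≤ -‖v‖² + M T² ballVol N`.
  set M := (b + 1) / δ with hMd
  have hM : 0 < M := by positivity
  obtain ⟨T, hT, hFT⟩ := exists_le_primitive hf1 hf2 hf3 hf4 hM.le
  refine ⟨√(M * T ^ 2 * ballVol N - c), ?_⟩
  rintro v hv ⟨y, hy⟩
  refine Real.le_sqrt_of_sq_le ?_
  have hF : Integrable fun x => primitive f x (v x) := integrable_primitive hs hN hf1 hf2 v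
  have h1 : ∫ x in Metric.ball y 1, primitive f x (v x) ≤ ∫ x, primitive f x (v x) :=
    setIntegral_le_integral hF
      (Eventually.of_forall fun x => primitive_nonneg hf1.1 hf2 hf4.gFun_nonneg x (v x))
  have i1 : IntegrableOn (fun x => M * v x ^ 2) (Metric.ball y 1) :=
    (v.integrable_sq.const_mul M).integrableOn
  have i2 : IntegrableOn (fun _ : E N => M * T ^ 2) (Metric.ball y 1) :=
    integrableOn_const measure_ball_lt_top.ne
  have h2 : ∫ x in Metric.ball y 1, (M * v x ^ 2 - M * T ^ 2) ≤
      ∫ x in Metric.ball y 1, primitive f x (v x) :=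
    integral_mono (i1.sub i2) hF.integrableOn fun x => hFT x (v x)
  have hvol : (volume : Measure (E N)).real (Metric.ball y 1) = ballVol N := by
    rw [Measure.real, volume_ball_eq y one_pos, one_pow, mul_one,
      ENNReal.toReal_ofReal (ballVol_pos N).le]
  rw [integral_sub i1 i2, integral_const_mul, setIntegral_const, hvol, smul_eq_mul] at h2
  have h3 := (hab v).2
  have h4 : (b + 1) * ‖v‖ ^ 2 ≤ M * ∫ x in Metric.ball y 1, v x ^ 2 := by
    calc (b + 1) * ‖v‖ ^ 2 = M * (δ * ‖v‖ ^ 2) := by rw [hMd]; field_simp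
      _ ≤ _ := by gcongr
  linarith

theorem energy_zero : energy V f (0 : Hs N s) = 0 := by
  have h1 : (fun x => (0 : Hs N s) x) =ᵐ[volume] fun _ => (0 : ℝ) := by
    have := coe_smul 0 (0 : Hs N s)
    rw [zero_smul] at this
    filter_upwards [this] with x hx
    rw [hx, zero_mul]
  have h2 : ∫ x, V x * (0 : Hs N s) x ^ 2 = 0 := by
    rw [integral_congr_ae (g := fun _ => (0 : ℝ)) (by filter_upwards [h1] with x hx; rw [hx]; simp)]
    simp
  have h3 : ∫ x, primitive f x ((0 : Hs N s) x) = 0 := by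
    rw [integral_congr_ae (g := fun _ => (0 : ℝ))
      (by filter_upwards [h1] with x hx; rw [hx, primitive_zero])]
    simp
  rw [energy, h2, h3, ← norm_quot_sq, map_zero]
  simp

/-- Almost critical points of large norm and bounded above energy carry a fixed fraction of their
mass in a unit ball. -/
theorem exists_concentration (hs : 0 < s) (hN : 2 * s < (N : ℝ)) (hV : CondV1 V)
    (hf1 : CondF1 s f) (hf2 : CondF2 f) (hf4 : CondF4 f) (c : ℝ) :
    ∃ δ : ℝ, 0 < δ ∧ ∃ R : ℝ, ∀ v : Hs N s, energy V f v ≤ c →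
      |fderiv ℝ (energy V f) v v| ≤ 1 → R ≤ ‖v‖ →
      ∃ y, δ * ‖v‖ ^ 2 < ∫ x in Metric.ball y 1, v x ^ 2 := by
  obtain ⟨a, b, ha, hb, hab⟩ := hV.exists_quadratic_bounds (f := f) (s := s)
  obtain ⟨l, hl, hG⟩ := hf4
  -- `A - 1` is to exceed `J(0) = 0`, the bound `c` for `J(v)`, and `l (2c + 1) / 2`, the bound that
  -- (f4) imposes on the energy at an interior critical point of the ray.
  set A := max (max 0 c) (l * (2 * c + 1) / 2) + 2 with hA
  have hA0 : 0 + 2 ≤ A := by rw [hA]; gcongr; exact (le_max_left _ _).trans (le_max_left _ _)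
  have hAc : c + 2 ≤ A := by rw [hA]; gcongr; exact (le_max_right _ _).trans (le_max_left _ _)
  have hAl : l * (2 * c + 1) / 2 + 2 ≤ A := by rw [hA]; gcongr; exact le_max_right _ _
  -- Since `ρ ≥ 1`, `a ρ² ≥ a ρ ≥ A`.
  set ρ := max 1 (A / a) with hρd
  have hρ1 : 1 ≤ ρ := le_max_left _ _
  have hρ : 0 < ρ := by linarith
  have hρA : A ≤ a * ρ ^ 2 := by
    have h1 : A ≤ a * ρ := by rw [← div_le_iff₀' ha]; exact le_max_right _ _
    nlinarith
  obtain ⟨δ, hδ, hδw⟩ := exists_integral_primitive_le_one hs hN hf1 hf2 hρ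
  -- Scaling `v` to norm `ρ` turns the fraction `δ / ρ²` of `‖v‖²` into the absolute mass `δ`;
  -- taking `R = ρ` puts the scaling factor in `(0, 1]`.
  refine ⟨δ / ρ ^ 2, by positivity, ρ, fun v hvc hvd hvR => ?_⟩
  by_contra! hcon
  have hvn : 0 < ‖v‖ := hρ.trans_le hvR
  set t₁ := ρ / ‖v‖ with ht₁
  have ht₁0 : 0 < t₁ := by positivity
  have ht₁1 : t₁ ≤ 1 := (div_le_one hvn).2 hvR
  have hwn : ‖t₁ • v‖ = ρ := by
    rw [norm_smul, Real.norm_eq_abs, abs_of_pos ht₁0, ht₁]; field_simp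
  have hlow : A - 1 ≤ energy V f (t₁ • v) := by
    have h1 := hδw (t₁ • v) hwn.le fun y => by
      have e1 : ∫ x in Metric.ball y 1, (t₁ • v) x ^ 2 =
          t₁ ^ 2 * ∫ x in Metric.ball y 1, v x ^ 2 := by
        rw [← integral_const_mul]
        refine integral_congr_ae (ae_restrict_of_ae ?_)
        filter_upwards [coe_smul t₁ v] with x hx
        rw [hx, mul_pow]
      rw [e1]
      calc _ ≤ t₁ ^ 2 * (δ / ρ ^ 2 * ‖v‖ ^ 2) := by gcongr; exact hcon y
        _ = δ := by rw [ht₁]; field_simp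
    have h2 := (hab (t₁ • v)).1
    rw [hwn] at h2
    linarith
  have hdiff : ∀ u : Hs N s, DifferentiableAt ℝ (energy V f) u := fun u =>
    (energy_differentiableAt hs hN hV hf1 hf2 u).1
  set g : ℝ → ℝ := fun t => energy V f (t • v) with hg
  have hgd : ∀ t, HasDerivAt g (fderiv ℝ (energy V f) (t • v) v) t := fun t => by
    have h1 : HasDerivAt (fun t : ℝ => t • v) ((1 : ℝ) • v) t := (hasDerivAt_id t).smul_const v
    rw [one_smul] at h1
    exact (hdiff (t • v)).hasFDerivAt.comp_hasDerivAt t h1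
  -- The value at `t₁` exceeds both endpoint values, so the maximum along the ray is interior and
  -- critical.
  obtain ⟨t₀, ht₀, hmax⟩ := isCompact_Icc.exists_isMaxOn (Set.nonempty_Icc.2 zero_le_one)
    (fun t _ => (hgd t).continuousAt.continuousWithinAt : ContinuousOn g (Set.Icc 0 1))
  have hgt : A - 1 ≤ g t₀ := hlow.trans (hmax ⟨ht₁0.le, ht₁1⟩)
  have hg0 : g 0 = 0 := by simp only [hg, zero_smul, energy_zero]
  have hg1 : g 1 = energy V f v := by simp only [hg, one_smul]
  have h0 : 0 < t₀ := by
    refine lt_of_le_of_ne ht₀.1 fun h => ?_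
    rw [← h, hg0] at hgt; linarith
  have h1 : t₀ < 1 := by
    refine lt_of_le_of_ne ht₀.2 fun h => ?_
    rw [h, hg1] at hgt; linarith
  have hcrit : fderiv ℝ (energy V f) (t₀ • v) v = 0 :=
    (hmax.isLocalMax (Icc_mem_nhds h0 h1)).hasDerivAt_eq_zero (hgd t₀)
  have hGt := (energy_differentiableAt hs hN hV hf1 hf2 (t₀ • v)).2
  rw [map_smul, hcrit, smul_zero, sub_zero] at hGt
  have hGv := (energy_differentiableAt hs hN hV hf1 hf2 v).2
  have hle : ∫ x, gFun f x ((t₀ • v) x) ≤ ∫ x, l * gFun f x (v x) := by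
    refine integral_mono_ae (integrable_gFun hs hN hf1 hf2 _)
      ((integrable_gFun hs hN hf1 hf2 v).const_mul l) ?_
    filter_upwards [coe_smul t₀ v] with x hx
    simp only [hx]
    exact hG x (v x) t₀ ht₀
  rw [integral_const_mul, ← hGt, ← hGv] at hle
  have h2 : 2 * energy V f v - fderiv ℝ (energy V f) v v ≤ 2 * c + 1 := by
    linarith [(abs_le.1 hvd).1]
  have h3 : l * (2 * energy V f v - fderiv ℝ (energy V f) v v) ≤ l * (2 * c + 1) := by gcongr
  have h4 : g t₀ = energy V f (t₀ • v) := rfl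
  linarith

end FracSchrodinger

/-! ### Boundedness of Cerami sequences -/

theorem lemma3p1 (N : ℕ) (s : ℝ) (hs : s ∈ Set.Ioo (0 : ℝ) 1) (hN : 2 * s < (N : ℝ))
    (V : FracSchrodinger.E N → ℝ) (f : FracSchrodinger.E N → ℝ → ℝ)
    (hV : FracSchrodinger.CondV1 V)
    (hf1 : FracSchrodinger.CondF1 s f) (hf2 : FracSchrodinger.CondF2 f)
    (hf3 : FracSchrodinger.CondF3 f) (hf4 : FracSchrodinger.CondF4 f)
    (c : ℝ) (v : ℕ → FracSchrodinger.Hs N s)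
    (hv : FracSchrodinger.IsCeramiSeq (FracSchrodinger.energy V f) c v) :
    Bornology.IsBounded (Set.range v) := by
  open FracSchrodinger in
  obtain ⟨hJ, hJd⟩ := hv
  -- One unit of slack on each side of `c` lets both bounds hold for all late terms with the same
  -- `δ`.
  obtain ⟨δ, hδ, R₁, hR₁⟩ := exists_concentration hs.1 hN hV hf1 hf2 hf4 (c + 1)
  obtain ⟨R₂, hR₂⟩ := exists_norm_le_of_concentration hs.1 hN hV hf1 hf2 hf3 hf4 hδ (c - 1)
  have h1 := hJ.eventually_le_const (show c < c + 1 by linarith)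
  have h2 := hJ.eventually_const_le (show c - 1 < c by linarith)
  have h3 := hJd.eventually_le_const one_pos
  obtain ⟨n₀, hn₀⟩ := eventually_atTop.1 (h1.and (h2.and h3))
  have htail : ∀ n, n₀ ≤ n → ‖v n‖ ≤ max R₁ R₂ := fun n hn => by
    obtain ⟨e1, e2, e3⟩ := hn₀ n hn
    rcases le_total ‖v n‖ R₁ with h | h
    · exact h.trans (le_max_left _ _)
    · refine (hR₂ (v n) e2 (hR₁ (v n) e1 ?_ h)).trans (le_max_right _ _)
      -- The weight `1 + ‖v n‖` in the Cerami condition is what controls `J'(v n)(v n)` without a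
      -- prior bound on `‖v n‖`.
      calc |fderiv ℝ (energy V f) (v n) (v n)| ≤ ‖fderiv ℝ (energy V f) (v n)‖ * ‖v n‖ :=
            (fderiv ℝ (energy V f) (v n)).le_opNorm _
        _ ≤ (1 + ‖v n‖) * ‖fderiv ℝ (energy V f) (v n)‖ := by
            linarith [norm_nonneg (fderiv ℝ (energy V f) (v n))]
        _ ≤ 1 := e3
  refine isBounded_iff_forall_norm_le.2
    -- The finite sum covers the terms before `n₀`.
    ⟨max R₁ R₂ + ∑ n ∈ Finset.range n₀, ‖v n‖, ?_⟩
  have hS : 0 ≤ ∑ n ∈ Finset.range n₀, ‖v n‖ := Finset.sum_nonneg fun _ _ => norm_nonneg _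
  have hR : 0 ≤ max R₁ R₂ := (norm_nonneg _).trans (htail n₀ le_rfl)
  rintro _ ⟨n, rfl⟩
  rcases le_or_gt n₀ n with hn | hn
  · linarith [htail n hn]
  · linarith [Finset.single_le_sum (fun n _ => norm_nonneg (v n)) (Finset.mem_range.2 hn)]
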